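/- Let $F$ be an algebraic function field of one variable with full constant field $\mathbb F_q$, of characteristic $p$ and genus $g$. Let $P_1,\dots,P_n$ be pairwise distinct rational places of $F$, put $D=P_1+\cdots+P_n$, and let $G$ be a divisor whose support is disjoint from that of $D$. For a divisor $B$ write $L(B)=\{h\in F\setminus\{0\} : (h)+B\ge 0\}\cup\{0\}$. For $Q(z)\in F[z]$, a rational place $P$ and $r\in\mathbb F_q$, say that $Q$ has a zero of multiplicity $m$ at $(P,r)$ if, for a local parameter $\phi$ of $P$, there are $c_{a,b}\in\mathbb F_q$ with $Q(z)=\sum_{a,b\ge 0,\ a+b\ge m}c_{a,b}\phi^a(z-r)^b$ and $c_{a,m-a}\neq 0$ for at least one $0\le a\le m$ (the sum over $a$ converging $P$-adically). Let $f\in L(G)$ and $\vec c=(f(P_1),\dots,f(P_n))$. Let $\vec r\in\mathbb F_q^n$ and let $\tau$ be the Hamming weight of $\vec r-\vec c$. Let $0\le t\le s\le \ell$ and $e\ge 0$ be integers with $s\ge 1$, and put \[\tau_t^{(e)}:=\frac{n\left(s(\ell-t+1)-\binom{s-t+1}{2}\right)-\left(\binom{\ell+1}{2}-\binom{t}{2}\right)\deg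 G}{\binom{s+1}{2}+s(\ell-t+1)-\binom{s-t+1}{2}}-\frac{1+g(\ell-t+1)}{p^e\left(\binom{s+1}{2}+s(\ell-t+1)-\binom{s-t+1}{2}\right)}.\] Assume that $\tau\le\tau_t^{(e)}$. Let $A$ be any divisor with support disjoint from that of $D$ satisfying $\deg A<p^es(n-\tau)$. Consider the nonzero polynomials $Q(z)=Q_\ell z^{p^e\ell}+\cdots+Q_1z^{p^e}+Q_0\in F[z]$ such that \begin{enumerate} \item $Q_j\in L(A-p^ejG)$ for $j=0,1,\dots,\ell$, and \item $Q(z)$ has a zero of multiplicity at least $p^es$ at $(P_i,r_i)$ for $i=1,\dots,n$. \end{enumerate} If $\deg A\ge p^es(n-\tau_t^{(e)})-1$ (in particular, if $\deg A=p^es(n-\tau)-1$), then such a polynomial exists. Moreover (without this lower bound on $\deg A$) any such polynomial has at most $\ell$ distinct roots in $F$, and $f$ is one of these. -/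

import Mathlib

open scoped Polynomial WithZero

noncomputable section

namespace AGCode

/-- A place of `F / K`, given by its valuation ring: a discrete valuation ring of `F`
containing the constants `K`. -/
structure Place (K F : Type*) [Field K] [Field F] [Algebra K F] where
  /-- The valuation ring of the place. -/
  ring : ValuationSubring F
  algebraMap_mem : ∀ a : K, algebraMap K F a ∈ ring
  isDVR : IsDiscreteValuationRing ring

variable {K F : Type*} [Field K] [Field F] [Algebra K F]

namespace Place

instance (P : Place K F) : IsDiscreteValuationRing P.ring := P.isDVR

instance (P : Place K F) : Algebra K P.ring :=
  ((algebraMap K F).codRestrict P.ring.toSubring P.algebraMap_mem).toAlgebra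

/-- The normalized discrete valuation of the place, written multiplicatively:
`P.val f = exp (-v_P f)` for `f ≠ 0`, and `P.val 0 = 0`. -/
def val (P : Place K F) : Valuation F ℤᵐ⁰ :=
  (IsDiscreteValuationRing.maximalIdeal P.ring).valuation F

theorem val_algebraMap_le_one (P : Place K F) (a : K) : P.val (algebraMap K F a) ≤ 1 :=
  (IsDiscreteValuationRing.maximalIdeal P.ring).valuation_le_one
    (⟨algebraMap K F a, P.algebraMap_mem a⟩ : P.ring)

/-- The degree of a place: the degree of its residue field over the constants. -/
def degree (P : Place K F) : ℕ :=
  Module.finrank K (IsLocalRing.ResidueField P.ring)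

/-- A place is rational if it has degree one. -/
def IsRational (P : Place K F) : Prop := P.degree = 1

/-- `φ` is a local parameter of `P`, i.e. `v_P φ = 1`. -/
def IsLocalParameter (P : Place K F) (φ : F) : Prop := P.val φ = WithZero.exp (-1 : ℤ)

open Classical in
/-- The value `f(P) ∈ K` of a function `f` regular at a rational place `P`: the element of `K`
that corresponds to the residue class of `f`. (It is `0` if `f` is not regular at `P`.) -/
def eval (P : Place K F) (f : F) : K :=
  if hf : f ∈ P.ring then
    Function.invFun (algebraMap K (IsLocalRing.ResidueField P.ring))
      (IsLocalRing.residue P.ring ⟨f, hf⟩)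
  else 0

/-- `Q(z) = ∑_{a,b} c_{a,b} φ^a (z - r)^b`. The coefficient of `(z - r)^b` in `Q` is the `b`-th
Taylor coefficient of `Q` at `r`, and it is required to be the `P`-adic limit of
`∑_{a < N} c_{a,b} φ^a`. -/
def HasExpansion (P : Place K F) (φ : F) (r : K) (Q : F[X]) (c : ℕ → ℕ → K) : Prop :=
  ∀ b N : ℕ,
    P.val ((Polynomial.taylor (algebraMap K F r) Q).coeff b
      - ∑ a ∈ Finset.range N, algebraMap K F (c a b) * φ ^ a) ≤ WithZero.exp (-(N : ℤ))

/-- `Q` has a zero of multiplicity (exactly) `m` at `(P, r)`. -/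
def HasZeroOfMultiplicity (P : Place K F) (r : K) (Q : F[X]) (m : ℕ) : Prop :=
  ∃ (φ : F) (c : ℕ → ℕ → K), P.IsLocalParameter φ ∧ P.HasExpansion φ r Q c ∧
    (∀ a b, a + b < m → c a b = 0) ∧ ∃ a ≤ m, c a (m - a) ≠ 0

/-- `Q` has a zero of multiplicity at least `m` at `(P, r)`. -/
def HasZeroOfMultiplicityAtLeast (P : Place K F) (r : K) (Q : F[X]) (m : ℕ) : Prop :=
  ∃ m' ≥ m, P.HasZeroOfMultiplicity r Q m'

end Place

variable (K F) in
/-- Divisors: finite formal `ℤ`-linear combinations of places. -/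
abbrev Divisor := Place K F →₀ ℤ

namespace Divisor

/-- The degree of a divisor. -/
def degree (A : Divisor K F) : ℤ := A.sum fun P m => m * (P.degree : ℤ)

/-- The Riemann-Roch space `L(A)`: the functions `f` with `f = 0` or
`v_P(f) ≥ -v_P(A)` for all places `P`. -/
def L (A : Divisor K F) : Submodule K F where
  carrier := {f | ∀ P : Place K F, P.val f ≤ WithZero.exp (A P)}
  add_mem' hf hg P := P.val.map_add_le (hf P) (hg P)
  zero_mem' P := by simp
  smul_mem' a f hf P := by
    rw [Algebra.smul_def, map_mul]
    exact (mul_le_mul' (P.val_algebraMap_le_one a) (hf P)).trans_eq (one_mul _)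

/-- The divisor `P_1 + ⋯ + P_n`. -/
def ofPoints {n : ℕ} (P : Fin n → Place K F) : Divisor K F :=
  ∑ i, Finsupp.single (P i) 1

end Divisor

variable (K F) in
/-- The genus of `F / K`: the maximum of `deg A - dim L(A) + 1` over all divisors `A`. -/
def genus : ℤ :=
  sSup (Set.range fun A : Divisor K F =>
    Divisor.degree A - (Module.finrank K (Divisor.L A) : ℤ) + 1)

/-- The evaluation map `ev_D(f) = (f(P_1), …, f(P_n))`. -/
def evD {n : ℕ} (P : Fin n → Place K F) (f : F) : Fin n → K := fun i => (P i).eval f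

/-- The decoding radius `τ_t^{(e)}`, as a function of `p`, `e`, `n`, `s`, `ℓ`, `t`, the degree `d`
of `G` and the genus `g`; only used for `t ≤ s ≤ ℓ`. -/
def radius (p e n s ℓ t : ℕ) (d g : ℤ) : ℚ :=
  ((n : ℚ) * ((s : ℚ) * ((ℓ : ℚ) - t + 1) - ((s - t + 1).choose 2 : ℚ))
      - (((ℓ + 1).choose 2 : ℚ) - (t.choose 2 : ℚ)) * (d : ℚ))
    / (((s + 1).choose 2 : ℚ) + (s : ℚ) * ((ℓ : ℚ) - t + 1) - ((s - t + 1).choose 2 : ℚ))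
  - (1 + (g : ℚ) * ((ℓ : ℚ) - t + 1))
    / ((p : ℚ) ^ e *
      (((s + 1).choose 2 : ℚ) + (s : ℚ) * ((ℓ : ℚ) - t + 1) - ((s - t + 1).choose 2 : ℚ)))

/-- `Q` is a nonzero polynomial `Q_ℓ z^{p^e ℓ} + ⋯ + Q_1 z^{p^e} + Q_0` with
`Q_j ∈ L(A - p^e j G)` for `0 ≤ j ≤ ℓ`, having a zero of multiplicity at least `p^e s` at each
`(P_i, r_i)`. -/
def IsInterpolationPolynomial (p e s ℓ : ℕ) {n : ℕ} (P : Fin n → Place K F) (r : Fin n → K)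
    (G A : Divisor K F) (Q : F[X]) : Prop :=
  Q ≠ 0 ∧
  (∃ q : ℕ → F,
    Q = ∑ j ∈ Finset.range (ℓ + 1), Polynomial.C (q j) * Polynomial.X ^ (p ^ e * j) ∧
    ∀ j ≤ ℓ, q j ∈ Divisor.L (A - (p ^ e * j) • G)) ∧
  ∀ i, (P i).HasZeroOfMultiplicityAtLeast (r i) Q (p ^ e * s)

end AGCode

end

/-! Write m = p^e and y = z^m. Every polynomial to be considered is Q(z) = R(y) with deg R ≤ ℓ.

Roots. In characteristic p the map x ↦ x^m is injective and sends roots of Q to roots of R, so there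
are at most ℓ of them. Since f ∈ L(G), each term Q_j f^(mj) lies in L(A), hence so does Q(f). At
each of the n - τ correct positions f - r_i vanishes at P_i, so Q(f) vanishes there to order at
least ms. Thus Q(f) lies in a Riemann-Roch space of degree deg A - ms(n - τ) < 0 and is zero
(`isRoot_of_isInterpolationPolynomial`).

Existence. Since f must be a root, the search is confined to R = ∑ B_j (y - f^m)^(t+j) with 0 ≤ j ≤
ℓ - t and B_j ∈ L(A - m(t+j)G); expanding the powers puts the coefficients of R in the required
spaces. An error position costs m·C(s+1,2) linear conditions. At a correct position f^m and r_i^m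
agree to order m, so conditions may be imposed around f^m instead of r_i^m
(`Place.val_coeff_taylor_le`). There the first t Taylor coefficients vanish identically, and only
m·C(s-t+1,2) conditions remain. Riemann's inequality bounds the number of unknowns below, and
`count_lt` checks that unknowns outnumber conditions; the radius is what this count yields.

The remaining input is the theory of function fields: principal divisors have degree 0, and deg -
dim is bounded on divisors, so that the supremum defining the genus is meaningful. Both rest on
`finite_of_reduction`, which bounds the size of a quotient killed by x by [F : K(x)], and on weak
approximation. -/

noncomputable section

namespace AGCode

/-! ### Algebraic function fields of one variable -/

open IntermediateField Module

/-- `F / K` is an algebraic function field of one variable with full constant field `K`. -/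
class IsAlgFunctionField (K F : Type*) [Field K] [Field F] [Algebra K F] : Prop where
  mem_range_of_isAlgebraic : ∀ x : F, IsAlgebraic K x → x ∈ Set.range (algebraMap K F)
  finiteDimensional_adjoin : ∀ x : F, Transcendental K x → FiniteDimensional K⟮x⟯ F
  exists_transcendental : ∃ x : F, Transcendental K x

/-- The transcendence degree of F is 1, so any transcendental x is a transcendence basis and F is
algebraic over K(x). It is also essentially of finite type, hence finite. Having this for every x
lets later arguments use a uniformizer or a nonunit as x. -/
theorem isAlgFunctionField_of_functionField {K F : Type*} [Field K] [Field F] [Algebra K F]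
    [Algebra (RatFunc K) F] [IsScalarTower K (RatFunc K) F] [FunctionField K F]
    (hconst : ∀ x : F, IsAlgebraic K x → x ∈ Set.range (algebraMap K F)) :
    IsAlgFunctionField K F where
  mem_range_of_isAlgebraic := hconst
  exists_transcendental :=
    ⟨algebraMap (RatFunc K) F RatFunc.X, by
      rw [transcendental_algebraMap_iff (algebraMap (RatFunc K) F).injective]
      exact RatFunc.transcendental_X⟩
  finiteDimensional_adjoin x hx := by
    have h1 : Algebra.trdeg K (RatFunc K) = 1 := by
      have : Algebra.IsAlgebraic K[X] (RatFunc K) :=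
        IsLocalization.isAlgebraic _ (nonZeroDivisors K[X])
      rw [← trdeg_add_eq K K[X] (A := RatFunc K), trdeg_eq_zero (R := K[X]), add_zero,
        Polynomial.trdeg_of_isDomain]
    have h2 : Algebra.trdeg K F = 1 := by
      have h := lift_trdeg_add_eq K (RatFunc K) F
      rw [trdeg_eq_zero (R := RatFunc K), h1] at h
      simpa using h.symm
    have hb : IsTranscendenceBasis K (fun _ : Unit => x) :=
      AlgebraicIndependent.isTranscendenceBasis_of_lift_trdeg_le_of_finite
        (algebraicIndependent_unique_type_iff.2 hx) (by simp [h2])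
    have h3 : Algebra.IsAlgebraic K⟮x⟯ F := by
      have := hb.isAlgebraic_field
      rwa [Set.range_const] at this
    have h4 : Algebra.EssFiniteType K[X] (RatFunc K) := .of_isLocalization _ (nonZeroDivisors K[X])
    have h5 : Algebra.EssFiniteType K (RatFunc K) := .comp _ K[X] _
    have h6 : Algebra.EssFiniteType K F := .comp _ (RatFunc K) _
    have h7 : Algebra.EssFiniteType K⟮x⟯ F := .of_comp K _ _
    exact Algebra.finite_of_essFiniteType_of_isAlgebraic

/-! ### Reduction modulo a transcendental element -/

section Reduction

variable {K F : Type*} [Field K] [Field F] [Algebra K F] {x : F}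
  {W : Type*} [AddCommGroup W] [Module K W]

/-- A family whose reduction modulo `x` is linearly independent over `K` is linearly independent
over `K(x)`. -/
theorem linearIndependent_adjoin_of_reduction (hx : Transcendental K x)
    (V : Submodule K F) (hV : ∀ v ∈ V, x * v ∈ V) (T : V →ₗ[K] W)
    (hT : ∀ v (hv : v ∈ V), T ⟨x * v, hV v hv⟩ = 0) {ι : Type*} (r : ι → V)
    (hr : LinearIndependent K (fun i => T (r i))) :
    LinearIndependent K⟮x⟯ (fun i => (r i : F)) := by
  have hx0 : x ≠ 0 := fun h => hx (h ▸ isAlgebraic_zero)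
  have haeval : ∀ (p : K[X]), ∀ v ∈ V, Polynomial.aeval x p * v ∈ V := by
    intro p
    induction p using Polynomial.induction_on' with
    | add p q hp hq =>
      intro v hv
      rw [map_add, add_mul]
      exact V.add_mem (hp v hv) (hq v hv)
    | monomial n a =>
      intro v hv
      rw [Polynomial.aeval_monomial, mul_assoc, ← Algebra.smul_def]
      refine V.smul_mem _ ?_
      induction n with
      | zero => simpa using hv
      | succ n ih => rw [pow_succ', mul_assoc]; exact hV _ ih
  -- Applying `T` to a relation with polynomial coefficients leaves a relation among the constant
  -- terms, which must therefore vanish. Dividing by x lowers the degrees, and induction finishes.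
  have key : ∀ (N : ℕ) (s : Finset ι) (g : ι → K[X]), (∀ i ∈ s, (g i).natDegree < N) →
      ∑ i ∈ s, Polynomial.aeval x (g i) * (r i : F) = 0 → ∀ i ∈ s, g i = 0 := by
    intro N
    induction N with
    | zero => exact fun s g h _ i hi => absurd (h i hi) (by simp)
    | succ N ih =>
      intro s g hdeg hsum
      have hg : ∀ i, Polynomial.aeval x (g i) = x * Polynomial.aeval x (g i).divX
          + algebraMap K F ((g i).coeff 0) := by
        intro i
        have h := congrArg (Polynomial.aeval x) (Polynomial.divX_mul_X_add (g i))
        rw [map_add, map_mul, Polynomial.aeval_X, Polynomial.aeval_C] at h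
        rw [mul_comm x, h]
      have hsplit : x * ∑ i ∈ s, Polynomial.aeval x (g i).divX * (r i : F)
          + ∑ i ∈ s, (g i).coeff 0 • (r i : F) = 0 := by
        rw [← hsum, Finset.mul_sum, ← Finset.sum_add_distrib]
        refine Finset.sum_congr rfl fun i _ => ?_
        rw [hg i, Algebra.smul_def]; ring
      have hmem : ∑ i ∈ s, Polynomial.aeval x (g i).divX * (r i : F) ∈ V :=
        V.sum_mem fun i _ => haeval _ _ (r i).2
      have h0 : ∑ i ∈ s, (g i).coeff 0 • T (r i) = 0 := by
        have h1 : (⟨_, hV _ hmem⟩ : V) + ∑ i ∈ s, (g i).coeff 0 • r i = 0 :=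
          Subtype.ext (by simpa using hsplit)
        have h2 := congrArg T h1
        rw [map_add, hT _ hmem, zero_add, map_sum, map_zero] at h2
        simpa using h2
      have hc := linearIndependent_iff'.1 hr s _ h0
      have hz : ∑ i ∈ s, Polynomial.aeval x (g i).divX * (r i : F) = 0 := by
        have : ∑ i ∈ s, (g i).coeff 0 • (r i : F) = 0 :=
          Finset.sum_eq_zero fun i hi => by rw [hc i hi, zero_smul]
        rw [this, add_zero] at hsplit
        exact (mul_eq_zero.1 hsplit).resolve_left hx0
      intro i hi
      by_cases hN : ∀ i ∈ s, (g i).divX.natDegree < N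
      · have := ih s (fun i => (g i).divX) hN hz i hi
        rw [← Polynomial.divX_mul_X_add (g i), this, hc i hi]
        simp
      -- Division by X fails to lower the degree bound only for N = 0. All coefficients are then
      -- constants, already known to vanish.
      · push Not at hN
        obtain ⟨j, hj, hjN⟩ := hN
        have h1 := hdeg j hj
        rw [Polynomial.natDegree_divX_eq_natDegree_tsub_one] at hjN
        have hN0 : N = 0 := by omega
        subst hN0
        have : (g i).natDegree = 0 := by have := hdeg i hi; omega
        rw [Polynomial.eq_C_of_natDegree_eq_zero this, hc i hi, map_zero]
  open scoped algebraAdjoinAdjoin in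
  refine (LinearIndependent.iff_fractionRing (Algebra.adjoin K {x}) K⟮x⟯).1 ?_
  rw [linearIndependent_iff']
  intro s g hg i hi
  have hp : ∀ i, ∃ p : K[X], Polynomial.aeval x p = (g i : F) := fun i => by
    have h := (Algebra.adjoin_singleton_eq_range_aeval K x).le (g i).2
    exact h
  choose p hp using hp
  have := key (s.sup (fun i => (p i).natDegree) + 1) s p
    (fun i hi => Nat.lt_succ_of_le (Finset.le_sup (f := fun i => (p i).natDegree) hi))
    (by simpa [hp, Algebra.smul_def, Subalgebra.algebraMap_def] using hg) i hi
  exact Subtype.ext (by rw [← hp i, this]; simp)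

theorem finite_of_reduction [FiniteDimensional K⟮x⟯ F] (hx : Transcendental K x)
    (V : Submodule K F) (hV : ∀ v ∈ V, x * v ∈ V) (T : V →ₗ[K] W)
    (hT : ∀ v (hv : v ∈ V), T ⟨x * v, hV v hv⟩ = 0)
    (hsurj : Function.Surjective T) :
    Module.Finite K W ∧ finrank K W ≤ finrank K⟮x⟯ F := by
  obtain ⟨ι, ⟨b⟩⟩ := Module.Basis.exists_basis K W
  choose r hr using fun i => hsurj (b i)
  have hli := linearIndependent_adjoin_of_reduction hx V hV T hT r
    (by simpa [hr] using b.linearIndependent)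
  have : Finite ι := hli.finite
  have : Fintype ι := Fintype.ofFinite ι
  refine ⟨Module.Finite.of_basis b, ?_⟩
  rw [finrank_eq_card_basis b]
  exact hli.fintype_card_le_finrank

end Reduction

/-! ### Existence of places -/

section Existence

variable {K F : Type*} [Field K] [Field F] [Algebra K F] [IsAlgFunctionField K F]

/-- A nonzero nonunit y is transcendental, because algebraic elements are constants. Reduction with
V = O and W = O/(y) then makes O/(y) finite over K. So every ideal is finitely generated, and a
Noetherian valuation ring is principal. -/
theorem isDiscreteValuationRing_of_nonunit (O : ValuationSubring F)
    (hK : ∀ a : K, algebraMap K F a ∈ O) (x : O) (hx0 : x ≠ 0) (hxu : ¬ IsUnit x) :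
    IsDiscreteValuationRing O := by
  let _ : Algebra K O := ((algebraMap K F).codRestrict O.toSubring hK).toAlgebra
  have : IsScalarTower K O F := IsScalarTower.of_algebraMap_eq fun a => rfl
  have hfin : ∀ y : O, y ≠ 0 → ¬ IsUnit y → Module.Finite K (O ⧸ Ideal.span {y}) := by
    intro y hy0 hyu
    have hy : Transcendental K (y : F) := by
      intro hy
      obtain ⟨a, ha⟩ := IsAlgFunctionField.mem_range_of_isAlgebraic _ hy
      have : algebraMap K O a = y := Subtype.ext ha
      refine hyu (this ▸ (IsUnit.mk0 a ?_).map (algebraMap K O))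
      rintro rfl
      exact hy0 (by rw [← this, map_zero])
    have := IsAlgFunctionField.finiteDimensional_adjoin _ hy
    let e : O →ₗ[K] F := (IsScalarTower.toAlgHom K O F).toLinearMap
    have he : Function.Injective e := Subtype.val_injective
    let eq := LinearEquiv.ofInjective e he
    let q : O →ₗ[K] (O ⧸ Ideal.span {y}) := (Ideal.Quotient.mkₐ K (Ideal.span {y})).toLinearMap
    have hV : ∀ v ∈ LinearMap.range e, (y : F) * v ∈ LinearMap.range e := by
      rintro _ ⟨v, rfl⟩
      exact ⟨y * v, rfl⟩
    refine (finite_of_reduction hy (LinearMap.range e) hV (q ∘ₗ eq.symm.toLinearMap) ?_ ?_).1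
    · rintro _ ⟨v, rfl⟩
      have : eq.symm ⟨(y : F) * e v, hV _ ⟨v, rfl⟩⟩ = y * v := by
        rw [LinearEquiv.symm_apply_eq]; rfl
      simp only [LinearMap.comp_apply, LinearEquiv.coe_coe, this]
      exact Ideal.Quotient.eq_zero_iff_mem.2
        (Ideal.mul_mem_right _ _ (Ideal.mem_span_singleton_self y))
    · exact (Ideal.Quotient.mk_surjective).comp eq.symm.surjective
  have hnoeth : IsNoetherianRing O := by
    rw [isNoetherianRing_iff_ideal_fg]
    intro I
    by_cases hI : I = ⊥
    · exact hI ▸ Submodule.fg_bot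
    obtain ⟨y, hyI, hy0⟩ := Submodule.exists_mem_ne_zero_of_ne_bot hI
    by_cases hyu : IsUnit y
    · rw [Ideal.eq_top_of_isUnit_mem _ hyI hyu]
      exact Module.Finite.fg_top
    have := hfin y hy0 hyu
    have : IsNoetherian O (O ⧸ Ideal.span {y}) :=
      isNoetherian_of_tower K (inferInstance : IsNoetherian K (O ⧸ Ideal.span {y}))
    refine Submodule.fg_of_fg_map_of_fg_inf_ker (Submodule.mkQ (Ideal.span {y}))
      (IsNoetherian.noetherian _) ?_
    rw [Submodule.ker_mkQ, inf_eq_right.2 ((Ideal.span_singleton_le_iff_mem _).2 hyI)]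
    exact Submodule.fg_span_singleton y
  have : IsPrincipalIdealRing O := inferInstance
  exact { not_a_field' := fun h => hx0 (by
            have : x ∈ IsLocalRing.maximalIdeal O := hxu
            rwa [h] at this) }

/-- Every transcendental function has a zero. -/
theorem exists_place_of_transcendental {x : F} (hx : Transcendental K x) :
    ∃ P : Place K F, x ∈ P.ring.nonunits := by
  have hx0 : x ≠ 0 := fun h => hx (h ▸ isAlgebraic_zero)
  let R := Algebra.adjoin K {x}
  let y : R.toSubring := ⟨x, Algebra.self_mem_adjoin_singleton K x⟩
  -- An inverse p(x) of x would make x a root of pX - 1, which is nonzero since its value at 0 is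
  -- -1. As x is not a unit of K[x], some valuation ring containing K[x] has x as a nonunit.
  have hI : Ideal.span {y} ≠ ⊤ := by
    intro h
    obtain ⟨⟨z, hz⟩, hz1⟩ := Ideal.mem_span_singleton'.1 ((Ideal.eq_top_iff_one _).1 h)
    obtain ⟨p, rfl⟩ := (Algebra.adjoin_singleton_eq_range_aeval K x).le hz
    refine hx ⟨p * Polynomial.X - 1, fun h0 => ?_, ?_⟩
    · have := congrArg (Polynomial.eval 0) h0
      simp at this
    · have := congrArg Subtype.val hz1
      simpa [sub_eq_zero] using this
  obtain ⟨O, hO, hO'⟩ := Ideal.image_subset_nonunits_valuationSubring _ hI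
  have hK : ∀ a : K, algebraMap K F a ∈ O := fun a => hO (R.algebraMap_mem a)
  have hxO : x ∈ O.nonunits := hO' ⟨y, Ideal.mem_span_singleton_self y, rfl⟩
  obtain ⟨hxm, hxn⟩ := ValuationSubring.mem_nonunits_iff_exists_mem_maximalIdeal.1 hxO
  exact ⟨⟨O, hK, isDiscreteValuationRing_of_nonunit O hK ⟨x, hxm⟩
    (fun h => hx0 (congrArg Subtype.val h)) hxn⟩, hxO⟩

end Existence

theorem finrank_pi_fin {K ι : Type*} [Field K] [Fintype ι] (v : ι → ℕ) (W : ι → Type*)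
    [∀ i, AddCommGroup (W i)] [∀ i, Module K (W i)]
    (hW : ∀ i, v i ≠ 0 → Module.Finite K (W i)) :
    finrank K (∀ i, Fin (v i) → W i) = ∑ i, v i * finrank K (W i) := by
  have : ∀ i, Module.Finite K (Fin (v i) → W i) := by
    intro i
    by_cases hi : v i = 0
    · rw [hi]
      infer_instance
    · have := hW i hi
      infer_instance
  rw [Module.finrank_pi_fintype]
  refine Finset.sum_congr rfl fun i _ => ?_
  by_cases hi : v i = 0
  · rw [hi, zero_mul]
    exact finrank_zero_of_subsingleton
  · have := hW i hi
    rw [Module.finrank_pi_fintype]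
    simp

/-! ### Digit expansions in a local domain with principal maximal ideal -/

section Digits

variable {K O : Type*} [Field K] [CommRing O] [IsDomain O] [IsLocalRing O] [Algebra K O]

/-- The digits of the elements of a discrete valuation ring with respect to a uniformizer `φ` and
a linear system `σ` of representatives of the residue field. -/
theorem exists_digits {φ : O} (hφ0 : φ ≠ 0)
    (hφ : IsLocalRing.maximalIdeal O = Ideal.span {φ})
    (σ : IsLocalRing.ResidueField O →ₗ[K] O) (hσ : ∀ c, IsLocalRing.residue O (σ c) = c) :
    ∃ d : O →ₗ[K] (ℕ → IsLocalRing.ResidueField O),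
      (∀ f N, ∃ g, f = ∑ a ∈ Finset.range N, σ (d f a) * φ ^ a + φ ^ N * g) ∧
      (∀ N (c : ℕ → IsLocalRing.ResidueField O), ∃ f, ∀ a < N, d f a = c a) ∧
      ∀ N f, ∀ a < N, d (φ ^ N * f) a = 0 := by
  have hφr : IsLocalRing.residue O φ = 0 :=
    (IsLocalRing.residue_eq_zero_iff _).2 (hφ ▸ Ideal.mem_span_singleton_self φ)
  -- The map (c, g) ↦ σ(c) + φg is a K-linear bijection. Its inverse reads off the first digit c and
  -- leaves g for the next one, so the digits are K-linear and completeness is not needed.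
  let m : (IsLocalRing.ResidueField O × O) →ₗ[K] O := σ.coprod (LinearMap.mulLeft K φ)
  have hm : ∀ c g, m (c, g) = σ c + φ * g := fun c g => by simp [m]
  have hinj : Function.Injective m := by
    rw [injective_iff_map_eq_zero]
    rintro ⟨c, g⟩ h
    rw [hm] at h
    have hc : c = 0 := by
      have := congrArg (IsLocalRing.residue O) h
      simpa [hσ, hφr] using this
    subst hc
    have : g = 0 := by simpa [hφ0] using h
    rw [this]; rfl
  have hsurj : Function.Surjective m := by
    intro f
    have : f - σ (IsLocalRing.residue O f) ∈ IsLocalRing.maximalIdeal O := by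
      rw [← IsLocalRing.residue_eq_zero_iff, map_sub, hσ, sub_self]
    rw [hφ, Ideal.mem_span_singleton'] at this
    obtain ⟨g, hg⟩ := this
    exact ⟨(IsLocalRing.residue O f, g), by rw [hm, mul_comm φ, hg]; ring⟩
  let e := (LinearEquiv.ofBijective m ⟨hinj, hsurj⟩).symm
  have hesymm : ∀ c g, e (σ c + φ * g) = (c, g) := fun c g => by
    rw [← hm]
    exact (LinearEquiv.ofBijective m ⟨hinj, hsurj⟩).symm_apply_apply (c, g)
  let sh : O →ₗ[K] O := LinearMap.snd K _ _ ∘ₗ e.toLinearMap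
  let d : O →ₗ[K] (ℕ → IsLocalRing.ResidueField O) :=
    LinearMap.pi fun a => (LinearMap.fst K _ _ ∘ₗ e.toLinearMap) ∘ₗ (sh ^ a)
  have hd0 : ∀ c g, d (σ c + φ * g) 0 = c := fun c g => by simp [d, hesymm]
  have hds : ∀ c g a, d (σ c + φ * g) (a + 1) = d g a := fun c g a => by
    have : sh (σ c + φ * g) = g := by simp [sh, hesymm]
    simp only [d, LinearMap.pi_apply, LinearMap.comp_apply, pow_succ, Module.End.mul_apply, this]
  refine ⟨d, fun f N => ?_, fun N => ?_, fun N => ?_⟩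
  · induction N generalizing f with
    | zero => exact ⟨f, by simp⟩
    | succ N ih =>
      obtain ⟨⟨c, g⟩, rfl⟩ := hsurj f
      obtain ⟨h, hh⟩ := ih g
      refine ⟨h, ?_⟩
      rw [hm, Finset.sum_range_succ']
      simp only [hds, hd0]
      conv_lhs => rw [hh]
      rw [mul_add, Finset.mul_sum]
      simp only [pow_succ]
      have : ∀ a, φ * (σ (d g a) * φ ^ a) = σ (d g a) * (φ ^ a * φ) := fun a => by ring
      simp only [this]
      ring
  · induction N with
    | zero => exact fun c => ⟨0, by simp⟩
    | succ N ih =>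
      intro c
      obtain ⟨g, hg⟩ := ih fun a => c (a + 1)
      refine ⟨σ (c 0) + φ * g, fun a ha => ?_⟩
      cases a with
      | zero => exact hd0 _ _
      | succ a => rw [hds, hg a (by omega)]
  · induction N with
    | zero => simp
    | succ N ih =>
      intro f a ha
      have h : φ ^ (N + 1) * f = σ 0 + φ * (φ ^ N * f) := by rw [map_zero]; ring
      rw [h]
      cases a with
      | zero => exact hd0 _ _
      | succ a => rw [hds, ih f a (by omega)]

end Digits

/-! ### Places: valuations, weak approximation, degrees -/

namespace Place

variable {K F : Type*} [Field K] [Field F] [Algebra K F] (P : Place K F)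

@[ext]
theorem ext {P Q : Place K F} (h : P.ring = Q.ring) : P = Q := by
  cases P; cases Q; congr

theorem val_coe_le_one (f : P.ring) : P.val (f : F) ≤ 1 :=
  (IsDiscreteValuationRing.maximalIdeal P.ring).valuation_le_one f

theorem val_coe_lt_one_iff (f : P.ring) :
    P.val (f : F) < 1 ↔ f ∈ IsLocalRing.maximalIdeal P.ring :=
  (IsDiscreteValuationRing.maximalIdeal P.ring).valuation_lt_one_iff_mem f

theorem val_le_one_iff {f : F} : P.val f ≤ 1 ↔ f ∈ P.ring := by
  refine ⟨fun h => ?_, fun h => P.val_coe_le_one ⟨f, h⟩⟩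
  by_contra hf
  have hf0 : f ≠ 0 := fun h0 => hf (h0 ▸ P.ring.zero_mem)
  have hinv : f⁻¹ ∈ P.ring := (P.ring.mem_or_inv_mem f).resolve_left hf
  have hm : (⟨f⁻¹, hinv⟩ : P.ring) ∈ IsLocalRing.maximalIdeal P.ring := by
    rw [IsLocalRing.mem_maximalIdeal, mem_nonunits_iff, isUnit_iff_exists_inv]
    rintro ⟨g, hg⟩
    have hg' : f⁻¹ * (g : F) = 1 := congrArg Subtype.val hg
    rw [inv_mul_eq_one₀ hf0] at hg'
    exact hf (hg' ▸ g.2)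
  have h1 := (P.val_coe_lt_one_iff _).2 hm
  simp only [map_inv₀] at h1
  exact absurd h (not_le.2 ((inv_lt_one₀ (by simpa [zero_lt_iff] using hf0)).1 h1))

theorem exists_isLocalParameter : ∃ φ : F, P.IsLocalParameter φ :=
  (IsDiscreteValuationRing.maximalIdeal P.ring).valuation_exists_uniformizer F

variable {P} in
theorem IsLocalParameter.ne_zero {φ : F} (h : P.IsLocalParameter φ) : φ ≠ 0 := by
  rintro rfl
  rw [IsLocalParameter, map_zero] at h
  exact WithZero.exp_ne_zero h.symm

variable {P} in
theorem IsLocalParameter.val_zpow {φ : F} (h : P.IsLocalParameter φ) (k : ℤ) :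
    P.val (φ ^ k) = WithZero.exp (-k) := by
  rw [map_zpow₀, h, ← WithZero.exp_zsmul]
  simp

variable {P} in
theorem IsLocalParameter.val_pow {φ : F} (h : P.IsLocalParameter φ) (k : ℕ) :
    P.val (φ ^ k) = WithZero.exp (-(k : ℤ)) := by
  simpa using h.val_zpow k

theorem val_algebraMap {a : K} (ha : a ≠ 0) : P.val (algebraMap K F a) = 1 := by
  refine le_antisymm (P.val_algebraMap_le_one a) ?_
  have h := P.val_algebraMap_le_one a⁻¹
  rw [map_inv₀, map_inv₀] at h
  exact (inv_le_one₀ (by simpa [zero_lt_iff] using ha)).1 h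

/-- The real absolute value attached to a place. -/
def abv : AbsoluteValue F ℝ :=
  (IsDiscreteValuationRing.maximalIdeal P.ring).adicAbv (b := 2) one_lt_two

theorem abv_le_abv_iff {f g : F} : P.abv f ≤ P.abv g ↔ P.val f ≤ P.val g := by
  have := (WithZeroMulInt.toNNReal_strictMono (e := 2) one_lt_two).le_iff_le
    (a := P.val f) (b := P.val g)
  rw [← this]
  exact NNReal.coe_le_coe

theorem abv_lt_abv_iff {f g : F} : P.abv f < P.abv g ↔ P.val f < P.val g := by
  rw [← not_le, ← not_le, abv_le_abv_iff]

theorem abv_isNontrivial : P.abv.IsNontrivial := by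
  obtain ⟨φ, hφ⟩ := P.exists_isLocalParameter
  refine ⟨φ, hφ.ne_zero, fun h => ?_⟩
  have h1 : P.abv φ < P.abv 1 := by
    rw [abv_lt_abv_iff, hφ, map_one, ← WithZero.exp_zero, WithZero.exp_lt_exp]
    norm_num
  rw [h, map_one] at h1
  exact lt_irrefl _ h1

theorem eq_of_abv_isEquiv {P Q : Place K F} (h : P.abv.IsEquiv Q.abv) : P = Q := by
  ext f
  rw [← P.val_le_one_iff, ← Q.val_le_one_iff, ← P.val.map_one, ← abv_le_abv_iff,
    h f 1, abv_le_abv_iff, P.val.map_one, Q.val.map_one]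

/-- Weak approximation for places. -/
theorem exists_val_sub_le {ι : Type*} [Finite ι] {P : ι → Place K F} (hP : Function.Injective P)
    (g : ι → F) (N : ι → ℤ) : ∃ f : F, ∀ i, (P i).val (f - g i) ≤ WithZero.exp (N i) := by
  have := Fintype.ofFinite ι
  have hd := AbsoluteValue.denseRange_algebraMap_pi (v := fun i => (P i).abv)
    (fun i => (P i).abv_isNontrivial)
    (fun i j hij h => hij (hP (eq_of_abv_isEquiv h)))
  choose φ hφ using fun i => (P i).exists_isLocalParameter
  let U : Set ((i : ι) → WithAbs (P i).abv) :=
    Set.pi Set.univ fun i => Metric.ball (WithAbs.toAbs _ (g i)) ((P i).abv (φ i ^ (-(N i))))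
  have hU : IsOpen U := isOpen_set_pi Set.finite_univ fun i _ => Metric.isOpen_ball
  obtain ⟨f, hf⟩ := hd.exists_mem_open hU ⟨fun i => WithAbs.toAbs _ (g i), fun i _ =>
    Metric.mem_ball_self ((P i).abv.pos (zpow_ne_zero _ (hφ i).ne_zero))⟩
  refine ⟨f, fun i => ?_⟩
  have h1 := hf i (Set.mem_univ i)
  rw [Metric.mem_ball, dist_eq_norm] at h1
  have h2 : (P i).abv (f - g i) < (P i).abv (φ i ^ (-(N i))) := h1
  rw [abv_lt_abv_iff, (hφ i).val_zpow, neg_neg] at h2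
  exact h2.le

variable {P} in
theorem IsLocalParameter.mem_ring {φ : F} (h : P.IsLocalParameter φ) : φ ∈ P.ring := by
  rw [← P.val_le_one_iff, h, ← WithZero.exp_zero, WithZero.exp_le_exp]
  norm_num

variable {P} in
theorem IsLocalParameter.val_le_exp_iff {φ : F} (h : P.IsLocalParameter φ) {f : F} {k : ℤ} :
    P.val f ≤ WithZero.exp k ↔ f * φ ^ k ∈ P.ring := by
  rw [← P.val_le_one_iff, map_mul, h.val_zpow, WithZero.exp_neg,
    mul_inv_le_iff₀ WithZero.exp_pos, one_mul]

variable {P} in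
theorem IsLocalParameter.val_le_exp_neg_iff {φ : F} (h : P.IsLocalParameter φ) {f : F} {N : ℕ} :
    P.val f ≤ WithZero.exp (-(N : ℤ)) ↔ ∃ g ∈ P.ring, f = φ ^ N * g := by
  rw [h.val_le_exp_iff]
  have h0 := pow_ne_zero N h.ne_zero
  constructor
  · intro hf
    refine ⟨_, hf, ?_⟩
    rw [zpow_neg, zpow_natCast]
    field_simp
  · rintro ⟨g, hg, rfl⟩
    convert hg using 1
    rw [zpow_neg, zpow_natCast]
    field_simp

variable {P} in
theorem IsLocalParameter.maximalIdeal_eq {φ : F} (h : P.IsLocalParameter φ) :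
    IsLocalRing.maximalIdeal P.ring = Ideal.span {(⟨φ, h.mem_ring⟩ : P.ring)} := by
  ext f
  rw [← P.val_coe_lt_one_iff, Ideal.mem_span_singleton']
  have h1 : P.val (f : F) < 1 ↔ P.val (f : F) ≤ WithZero.exp (-((1 : ℕ) : ℤ)) := by
    rw [← WithZero.exp_zero]
    rcases eq_or_ne (P.val (f : F)) 0 with h0 | h0
    · simp [h0]
    · rw [← WithZero.log_lt_iff_lt_exp h0, ← WithZero.log_le_iff_le_exp h0]
      simp only [Nat.cast_one]
      omega
  rw [h1, h.val_le_exp_neg_iff]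
  constructor
  · rintro ⟨g, hg, hfg⟩
    exact ⟨⟨g, hg⟩, Subtype.ext (by simp [hfg, mul_comm])⟩
  · rintro ⟨g, rfl⟩
    exact ⟨g, g.2, by simp [mul_comm]⟩

theorem exists_section :
    ∃ σ : IsLocalRing.ResidueField P.ring →ₗ[K] P.ring,
      ∀ c, IsLocalRing.residue P.ring (σ c) = c := by
  obtain ⟨σ, hσ⟩ := LinearMap.exists_rightInverse_of_surjective
    (IsScalarTower.toAlgHom K P.ring (IsLocalRing.ResidueField P.ring)).toLinearMap
    (LinearMap.range_eq_top.2 IsLocalRing.residue_surjective)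
  exact ⟨σ, fun c => LinearMap.congr_fun hσ c⟩

/-- The elements of the valuation ring modulo the `N`-th power of the maximal ideal. -/
theorem exists_truncation (N : ℕ) :
    ∃ T : P.ring →ₗ[K] (Fin N → IsLocalRing.ResidueField P.ring), Function.Surjective T ∧
      ∀ f, T f = 0 ↔ P.val (f : F) ≤ WithZero.exp (-(N : ℤ)) := by
  obtain ⟨φ, hφ⟩ := P.exists_isLocalParameter
  obtain ⟨σ, hσ⟩ := P.exists_section
  obtain ⟨d, hd, hds, hd0⟩ := exists_digits (K := K) (φ := (⟨φ, hφ.mem_ring⟩ : P.ring))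
    (fun h => hφ.ne_zero (congrArg Subtype.val h)) hφ.maximalIdeal_eq σ hσ
  refine ⟨LinearMap.pi fun a => LinearMap.proj (a : ℕ) ∘ₗ d, fun c => ?_, fun f => ?_⟩
  · obtain ⟨f, hf⟩ := hds N fun a => if h : a < N then c ⟨a, h⟩ else 0
    exact ⟨f, funext fun a => by simp [hf a a.2]⟩
  · rw [hφ.val_le_exp_neg_iff]
    constructor
    · intro h
      obtain ⟨g, hg⟩ := hd f N
      rw [Finset.sum_eq_zero, zero_add] at hg
      · exact ⟨g, g.2, by conv_lhs => rw [hg]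
                          rfl⟩
      · intro a ha
        have : d f a = 0 := congrFun h (⟨a, Finset.mem_range.1 ha⟩ : Fin N)
        rw [this, map_zero, zero_mul]
    · rintro ⟨g, hg, hfg⟩
      have : f = (⟨φ, hφ.mem_ring⟩ : P.ring) ^ N * ⟨g, hg⟩ := Subtype.ext hfg
      ext a
      rw [this]
      exact hd0 N _ a a.2

/-- The sum over finitely many zeros of `x` of multiplicity times degree is at most `[F : K(x)]`. -/
theorem sum_mul_degree_le [IsAlgFunctionField K F] {x : F} (hx : Transcendental K x)
    {ι : Type*} [Fintype ι] {P : ι → Place K F} (hP : Function.Injective P) (v : ι → ℕ)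
    (hv : ∀ i, (P i).val x ≤ WithZero.exp (-(v i : ℤ))) :
    (∀ i, v i ≠ 0 → Module.Finite K (IsLocalRing.ResidueField (P i).ring)) ∧
    ∑ i, v i * (P i).degree ≤ finrank K⟮x⟯ F := by
  have := IsAlgFunctionField.finiteDimensional_adjoin x hx
  choose T hTs hT using fun i => (P i).exists_truncation (v i)
  -- V consists of the functions regular at all P_i, reduced modulo the v_i-th power of each maximal
  -- ideal. This kills xV because x vanishes to order v_i, and it is onto by weak approximation. The
  -- target has dimension ∑ v_i deg P_i.
  let V : Submodule K F :=
    { carrier := {f | ∀ i, f ∈ (P i).ring}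
      add_mem' := fun hf hg i => add_mem (hf i) (hg i)
      zero_mem' := fun i => zero_mem _
      smul_mem' := fun a f hf i => by
        rw [Algebra.smul_def]
        exact mul_mem ((P i).algebraMap_mem a) (hf i) }
  let ev : ∀ i, V →ₗ[K] (P i).ring := fun i =>
    { toFun := fun f => ⟨f, f.2 i⟩
      map_add' := fun f g => rfl
      map_smul' := fun a f => Subtype.ext (Algebra.smul_def a (f : F)) }
  let U : V →ₗ[K] (∀ i, Fin (v i) → IsLocalRing.ResidueField (P i).ring) :=
    LinearMap.pi fun i => T i ∘ₗ ev i
  have hxV : ∀ i, x ∈ (P i).ring := fun i => by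
    rw [← val_le_one_iff, ← WithZero.exp_zero]
    exact (hv i).trans (WithZero.exp_le_exp.2 (by omega))
  have hV : ∀ f ∈ V, x * f ∈ V := fun f hf i => mul_mem (hxV i) (hf i)
  have hU : Function.Surjective U := by
    intro w
    choose g hg using fun i => hTs i (w i)
    obtain ⟨f, hf⟩ := exists_val_sub_le hP (fun i => (g i : F)) (fun i => -(v i : ℤ))
    have hsub : ∀ i, f - g i ∈ (P i).ring := fun i => by
      rw [← val_le_one_iff, ← WithZero.exp_zero]
      exact (hf i).trans (WithZero.exp_le_exp.2 (by omega))
    have hfV : f ∈ V := fun i => by simpa using add_mem (hsub i) (g i).2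
    refine ⟨⟨f, hfV⟩, funext fun i => ?_⟩
    rw [← hg i, ← sub_eq_zero]
    change T i (ev i ⟨f, hfV⟩) - T i (g i) = 0
    rw [← map_sub, hT]
    exact hf i
  have hfin := finite_of_reduction hx V hV U (fun f hf => ?_) hU
  · have hW := hfin.1
    have hfi : ∀ i, v i ≠ 0 → Module.Finite K (IsLocalRing.ResidueField (P i).ring) := by
      intro i hi
      have : NeZero (v i) := ⟨hi⟩
      refine Module.Finite.of_surjective
        (LinearMap.proj (0 : Fin (v i)) ∘ₗ LinearMap.proj i :
          (∀ i, Fin (v i) → IsLocalRing.ResidueField (P i).ring) →ₗ[K] _) ?_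
      classical
      intro c
      exact ⟨Pi.single i fun _ => c, by simp⟩
    exact ⟨hfi, (finrank_pi_fin v _ hfi).symm.trans_le hfin.2⟩
  · funext i
    change T i (ev i _) = 0
    rw [hT]
    change (P i).val (x * f) ≤ _
    rw [map_mul]
    exact (mul_le_mul' (hv i) ((P i).val_le_one_iff.2 (hf i))).trans_eq (mul_one _)

end Place

variable {K F : Type*} [Field K] [Field F] [Algebra K F]

/-- The powers of x are independent over K inside K(x), and independence multiplies along the tower
K ⊆ K(x) ⊆ F. -/
theorem linearIndependent_pow_mul {x : F} (hx : Transcendental K x) {ι : Type*} {u : ι → F}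
    (hu : LinearIndependent K⟮x⟯ u) : LinearIndependent K (fun q : ℕ × ι => x ^ q.1 * u q.2) := by
  have hpow : LinearIndependent K (fun i : ℕ => AdjoinSimple.gen K x ^ i) := by
    have h : LinearIndependent K (fun i : ℕ => x ^ i) := by
      have := (Polynomial.basisMonomials K).linearIndependent.map'
        (Polynomial.aeval x).toLinearMap
        (LinearMap.ker_eq_bot.2 (transcendental_iff_injective.1 hx))
      have e : (fun i : ℕ => x ^ i) =
          (Polynomial.aeval x).toLinearMap ∘ Polynomial.basisMonomials K := by
        ext i; simp
      rw [e]
      exact this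
    refine LinearIndependent.of_comp (IsScalarTower.toAlgHom K K⟮x⟯ F).toLinearMap ?_
    convert h using 2 with i
    simp
  convert linearIndependent_smul hpow hu using 2 with q
  rw [Algebra.smul_def]
  simp

namespace Place

variable [IsAlgFunctionField K F]

theorem transcendental_of_val_ne_one (P : Place K F) {x : F} (hx0 : x ≠ 0) (hx : P.val x ≠ 1) :
    Transcendental K x := by
  intro h
  obtain ⟨a, rfl⟩ := IsAlgFunctionField.mem_range_of_isAlgebraic x h
  exact hx (P.val_algebraMap fun h => hx0 (by rw [h, map_zero]))

instance finite_residueField (P : Place K F) :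
    Module.Finite K (IsLocalRing.ResidueField P.ring) := by
  obtain ⟨φ, hφ⟩ := P.exists_isLocalParameter
  have ht : Transcendental K φ := P.transcendental_of_val_ne_one hφ.ne_zero (by
    rw [hφ, Ne, WithZero.exp_eq_one]; norm_num)
  exact (sum_mul_degree_le (ι := Unit) ht (P := fun _ => P) (Function.injective_of_subsingleton _)
    (fun _ => 1) (fun _ => by rw [hφ]; simp)).1 () one_ne_zero

theorem degree_pos (P : Place K F) : 0 < P.degree := finrank_pos

/-- Each zero contributes at least 1 to a sum bounded by [F : K(x)]. -/
theorem finite_setOf_val_lt_one {x : F} (hx : Transcendental K x) :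
    {P : Place K F | P.val x < 1}.Finite := by
  by_contra hinf
  obtain ⟨S, hS, hcard⟩ := Set.Infinite.exists_subset_card_eq hinf (finrank K⟮x⟯ F + 1)
  have h := (sum_mul_degree_le (ι := S) hx (P := fun P => (P : Place K F))
    Subtype.val_injective (fun _ => 1) (fun P => by
      have h0 : (P : Place K F).val x ≠ 0 := by
        rw [Ne, map_eq_zero]
        rintro rfl
        exact hx isAlgebraic_zero
      have h1 : (P : Place K F).val x < 1 := hS P.2
      rw [← WithZero.exp_zero, ← WithZero.log_lt_iff_lt_exp h0] at h1
      rw [← WithZero.log_le_iff_le_exp h0]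
      simp only [Nat.cast_one]
      omega)).2
  have h2 : ∑ P : S, 1 ≤ ∑ P : S, 1 * (P : Place K F).degree :=
    Finset.sum_le_sum fun P _ => by rw [one_mul]; exact (P : Place K F).degree_pos
  simp only [Finset.sum_const, Finset.card_univ, Fintype.card_coe, hcard, smul_eq_mul] at h2
  omega

theorem finite_setOf_val_ne_one {x : F} (hx0 : x ≠ 0) :
    {P : Place K F | P.val x ≠ 1}.Finite := by
  by_cases hx : Transcendental K x
  · have hx' : Transcendental K x⁻¹ := fun h => hx (by simpa using h.inv)
    refine ((finite_setOf_val_lt_one hx).union (finite_setOf_val_lt_one hx')).subset fun P hP => ?_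
    rcases lt_or_gt_of_ne hP with h | h
    · exact Or.inl h
    · right
      rw [Set.mem_ofPred_eq, map_inv₀]
      exact inv_lt_one_of_one_lt₀ h
  · have : {P : Place K F | P.val x ≠ 1} = ∅ :=
      Set.eq_empty_of_forall_notMem fun P hP => hx (P.transcendental_of_val_ne_one hx0 hP)
    rw [this]
    exact Set.finite_empty

end Place

/-! ### Divisors and Riemann-Roch spaces -/

namespace Divisor

section Degree

theorem degree_add (A B : Divisor K F) : degree (A + B) = degree A + degree B :=
  Finsupp.sum_add_index' (fun _ => zero_mul _) fun _ _ _ => add_mul _ _ _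

@[simp]
theorem degree_zero : degree (0 : Divisor K F) = 0 := Finsupp.sum_zero_index

variable (K F) in
/-- The degree as a homomorphism. -/
def degreeHom : Divisor K F →+ ℤ where
  toFun := degree
  map_zero' := degree_zero
  map_add' := degree_add

theorem degree_neg (A : Divisor K F) : degree (-A) = -degree A := map_neg (degreeHom K F) A

theorem degree_sub (A B : Divisor K F) : degree (A - B) = degree A - degree B :=
  map_sub (degreeHom K F) A B

theorem degree_nsmul (n : ℕ) (A : Divisor K F) : degree (n • A) = n * degree A :=
  (map_nsmul (degreeHom K F) n A).trans (nsmul_eq_mul _ _)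

theorem degree_sum {ι : Type*} (s : Finset ι) (A : ι → Divisor K F) :
    degree (∑ i ∈ s, A i) = ∑ i ∈ s, degree (A i) := map_sum (degreeHom K F) A s

theorem degree_single (P : Place K F) (m : ℤ) :
    degree (Finsupp.single P m) = m * P.degree :=
  Finsupp.sum_single_index (zero_mul _)

theorem degree_nonneg {A : Divisor K F} (hA : 0 ≤ A) : 0 ≤ degree A :=
  Finset.sum_nonneg fun P _ => mul_nonneg (hA P) (Int.natCast_nonneg _)

theorem degree_mono {A B : Divisor K F} (h : A ≤ B) : degree A ≤ degree B := by
  have := degree_nonneg (sub_nonneg.2 h)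
  rw [degree_sub] at this
  omega

end Degree

theorem mem_L {A : Divisor K F} {f : F} : f ∈ L A ↔ ∀ P, P.val f ≤ WithZero.exp (A P) := Iff.rfl

theorem L_mono {A B : Divisor K F} (h : A ≤ B) : L A ≤ L B := fun _ hf P =>
  (hf P).trans (WithZero.exp_le_exp.2 (h P))

theorem mul_mem_L {A B : Divisor K F} {f g : F} (hf : f ∈ L A) (hg : g ∈ L B) :
    f * g ∈ L (A + B) := fun P => by
  rw [map_mul, Finsupp.add_apply, WithZero.exp_add]
  exact mul_le_mul' (hf P) (hg P)

theorem one_mem_L_zero : (1 : F) ∈ L (0 : Divisor K F) := fun P => by simp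

theorem pow_mem_L {A : Divisor K F} {f : F} (hf : f ∈ L A) (n : ℕ) : f ^ n ∈ L (n • A) := by
  induction n with
  | zero => simpa using one_mem_L_zero
  | succ n ih =>
    rw [pow_succ, succ_nsmul]
    exact mul_mem_L ih hf

variable [IsAlgFunctionField K F]

/-- The divisor of a nonzero function. -/
def div (x : F) : Divisor K F :=
  Finsupp.ofSupportFinite (fun P => -WithZero.log (P.val x)) (by
    by_cases hx : x = 0
    · subst hx
      convert Set.finite_empty
      simp
    · refine (Place.finite_setOf_val_ne_one (K := K) hx).subset fun P hP h => hP ?_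
      simp [h])

theorem div_apply (x : F) (P : Place K F) : div x P = -WithZero.log (P.val x) := rfl

theorem val_eq_exp_neg_div {x : F} (hx : x ≠ 0) (P : Place K F) :
    P.val x = WithZero.exp (-(div x P)) := by
  rw [div_apply, neg_neg, WithZero.exp_log]
  simpa using hx

theorem div_inv (x : F) : div x⁻¹ = -div (K := K) x := by
  ext P
  simp [div_apply, WithZero.log_inv]

theorem mem_L_iff {A : Divisor K F} {x : F} (hx : x ≠ 0) : x ∈ L A ↔ -div x ≤ A := by
  rw [mem_L]
  refine forall_congr' fun P => ?_
  rw [val_eq_exp_neg_div hx, WithZero.exp_le_exp]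
  rfl

section Dimension

/-- Multiplying by φ^(A(P)+1) and taking the residue at P maps L(A+P) to the residue field, of
dimension deg P, with kernel contained in L(A). -/
theorem finrank_L_add_single_le (A : Divisor K F) (P : Place K F) [Module.Finite K (L A)] :
    Module.Finite K (L (A + Finsupp.single P 1)) ∧
    finrank K (L (A + Finsupp.single P 1)) ≤ finrank K (L A) + P.degree := by
  obtain ⟨φ, hφ⟩ := P.exists_isLocalParameter
  let B := A + Finsupp.single P 1
  have hB : ∀ f : L B, (f : F) * φ ^ (A P + 1) ∈ P.ring := fun f => by
    have := f.2 P
    rw [hφ.val_le_exp_iff] at this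
    simpa [B] using this
  let m : L B →ₗ[K] P.ring :=
    { toFun := fun f => ⟨f * φ ^ (A P + 1), hB f⟩
      map_add' := fun f g => Subtype.ext (add_mul _ _ _)
      map_smul' := fun a f => Subtype.ext (by
        change (a • (f : F)) * _ = algebraMap K F a * (f * φ ^ (A P + 1))
        rw [Algebra.smul_def, mul_assoc]) }
  let T : L B →ₗ[K] IsLocalRing.ResidueField P.ring :=
    (IsScalarTower.toAlgHom K P.ring (IsLocalRing.ResidueField P.ring)).toLinearMap ∘ₗ m
  have hker : ∀ f ∈ LinearMap.ker T, (f : F) ∈ L A := by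
    intro f hf Q
    by_cases hQ : Q = P
    · subst hQ
      have h1 : IsLocalRing.residue Q.ring (m f) = 0 := hf
      rw [IsLocalRing.residue_eq_zero_iff, ← Q.val_coe_lt_one_iff] at h1
      have h2 : Q.val ((f : F) * φ ^ (A Q + 1)) < 1 := h1
      rw [map_mul, hφ.val_zpow, WithZero.exp_neg, mul_inv_lt_iff₀ WithZero.exp_pos, one_mul] at h2
      rcases eq_or_ne (Q.val (f : F)) 0 with h0 | h0
      · simp [h0]
      · rw [← WithZero.log_lt_iff_lt_exp h0] at h2
        rw [← WithZero.log_le_iff_le_exp h0]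
        omega
    · have := f.2 Q
      simpa [B, Finsupp.single_eq_of_ne hQ] using this
  let j : LinearMap.ker T →ₗ[K] L A :=
    { toFun := fun f => ⟨f.1, hker f.1 f.2⟩
      map_add' := fun f g => rfl
      map_smul' := fun a f => rfl }
  have hj : Function.Injective j := fun f g h =>
    Subtype.ext (Subtype.ext (congrArg (fun z : L A => (z : F)) h))
  have hkfin : Module.Finite K (LinearMap.ker T) := Module.Finite.of_injective j hj
  have hBfin : Module.Finite K (L B) :=
    ⟨Submodule.fg_of_fg_map_of_fg_inf_ker T (IsNoetherian.noetherian _)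
      (by rw [top_inf_eq]; exact Module.Finite.iff_fg.1 hkfin)⟩
  refine ⟨hBfin, ?_⟩
  have h1 := LinearMap.finrank_range_add_finrank_ker T
  have h2 := LinearMap.finrank_le_finrank_of_injective hj
  have h3 := Submodule.finrank_le (LinearMap.range T)
  change finrank K (L B) ≤ finrank K (L A) + finrank K (IsLocalRing.ResidueField P.ring)
  omega

theorem finrank_L_add_le {D : Divisor K F} (hD : 0 ≤ D) :
    ∀ (A : Divisor K F), Module.Finite K (L A) → Module.Finite K (L (A + D)) ∧
      (finrank K (L (A + D)) : ℤ) ≤ finrank K (L A) + degree D := by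
  have hsingle : ∀ (P : Place K F) (k : ℕ) (A : Divisor K F), Module.Finite K (L A) →
      Module.Finite K (L (A + Finsupp.single P (k : ℤ))) ∧
      (finrank K (L (A + Finsupp.single P (k : ℤ))) : ℤ) ≤
        finrank K (L A) + degree (Finsupp.single P (k : ℤ)) := by
    intro P k A hA
    induction k with
    | zero =>
      rw [Nat.cast_zero, Finsupp.single_zero, add_zero]
      exact ⟨hA, by simp⟩
    | succ k ih =>
      have := ih.1
      have h := finrank_L_add_single_le (A + Finsupp.single P (k : ℤ)) P
      rw [Nat.cast_succ, Finsupp.single_add, ← add_assoc]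
      refine ⟨h.1, ?_⟩
      rw [degree_add, degree_single P 1, one_mul]
      have h1 := ih.2
      have h2 : ((finrank K (L (A + Finsupp.single P (k : ℤ) + Finsupp.single P 1)) : ℕ) : ℤ) ≤
        (finrank K (L (A + Finsupp.single P (k : ℤ))) + P.degree : ℕ) := by exact_mod_cast h.2
      push_cast at h2
      omega
  induction D using Finsupp.induction with
  | zero =>
    intro A hA
    rw [add_zero]
    exact ⟨hA, by simp⟩
  | single_add P b D hPD hb ih =>
    intro A hA
    have hDP : D P = 0 := Finsupp.notMem_support_iff.1 hPD
    have hb0 : 0 ≤ b := by simpa [hDP] using hD P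
    have hD0 : 0 ≤ D := fun Q => by
      by_cases hQ : Q = P
      · subst hQ; simp [hDP]
      · simpa [Finsupp.single_eq_of_ne hQ] using hD Q
    lift b to ℕ using hb0
    have h1 := hsingle P b A hA
    have h2 := ih hD0 _ h1.1
    rw [← add_assoc, degree_add]
    refine ⟨h2.1, ?_⟩
    have := h1.2
    have := h2.2
    omega

/-- A nonconstant f is transcendental, and a zero of its inverse is a pole of f. -/
theorem mem_L_zero_iff {f : F} : f ∈ L (0 : Divisor K F) ↔ f ∈ Set.range (algebraMap K F) := by
  constructor
  · intro hf
    refine IsAlgFunctionField.mem_range_of_isAlgebraic f (by_contra fun ht => ?_)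
    have ht' : Transcendental K f⁻¹ := fun h => ht (by simpa using h.inv)
    obtain ⟨P, hP⟩ := exists_place_of_transcendental ht'
    obtain ⟨hm, hmax⟩ := ValuationSubring.mem_nonunits_iff_exists_mem_maximalIdeal.1 hP
    have h1 : P.val f⁻¹ < 1 := (P.val_coe_lt_one_iff ⟨_, hm⟩).2 hmax
    have h2 : P.val f ≤ 1 := by simpa using hf P
    have hf0 : f ≠ 0 := fun h => ht (h ▸ isAlgebraic_zero)
    rw [map_inv₀, inv_lt_one₀ (by simpa [zero_lt_iff] using hf0)] at h1
    exact absurd h2 (not_le.2 h1)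
  · rintro ⟨a, rfl⟩ P
    simpa using P.val_algebraMap_le_one a

theorem finrank_L_zero_le :
    Module.Finite K (L (0 : Divisor K F)) ∧ finrank K (L (0 : Divisor K F)) ≤ 1 := by
  let c : K →ₗ[K] L (0 : Divisor K F) :=
    (Algebra.linearMap K F).codRestrict _ fun a => mem_L_zero_iff.2 ⟨a, rfl⟩
  have hc : Function.Surjective c := fun f => by
    obtain ⟨a, ha⟩ := mem_L_zero_iff.1 f.2
    exact ⟨a, Subtype.ext ha⟩
  refine ⟨Module.Finite.of_surjective c hc, ?_⟩
  rw [← finrank_self K]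
  exact LinearMap.finrank_le_finrank_of_surjective hc

instance finite_L (A : Divisor K F) : Module.Finite K (L A) := by
  have h := (finrank_L_add_le (D := A ⊔ 0) le_sup_right 0 finrank_L_zero_le.1).1
  rw [zero_add] at h
  exact Submodule.finiteDimensional_of_le (L_mono (le_sup_left : A ≤ A ⊔ 0))

theorem finrank_L_le {A : Divisor K F} (hA : 0 ≤ A) : (finrank K (L A) : ℤ) ≤ degree A + 1 := by
  have h := (finrank_L_add_le hA 0 finrank_L_zero_le.1).2
  rw [zero_add] at h
  have := (finrank_L_zero_le (K := K) (F := F)).2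
  omega

theorem finrank_L_sub_degree_anti {A B : Divisor K F} (h : A ≤ B) :
    degree A - (finrank K (L A) : ℤ) ≤ degree B - (finrank K (L B) : ℤ) := by
  have h := (finrank_L_add_le (sub_nonneg.2 h) A inferInstance).2
  rw [add_sub_cancel, degree_sub] at h
  omega

end Dimension

/-! ### Principal divisors have degree zero -/

section Principal

/-- `[F : K(x)]` is bounded by the dimension of `L(lB + C)`, where `x ∈ L(B)`. -/
theorem exists_mul_finrank_le {x : F} (hx : Transcendental K x) :
    ∃ C : Divisor K F, 0 ≤ C ∧ ∀ B : Divisor K F, 0 ≤ B → x ∈ L B → ∀ l : ℕ,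
      (l + 1) * finrank K⟮x⟯ F ≤ finrank K (L (l • B + C)) := by
  have := IsAlgFunctionField.finiteDimensional_adjoin x hx
  let u := Module.finBasis K⟮x⟯ F
  -- C dominates the poles of a K(x)-basis u_j of F. So the products x^i u_j with i ≤ l, which are
  -- independent over K, all lie in L(lB + C).
  let C : Divisor K F := ∑ j, ((-div (u j)) ⊔ 0)
  have hC : ∀ j, (-div (u j)) ⊔ 0 ≤ C := fun j =>
    Finset.single_le_sum (f := fun j => (-div (K := K) (u j)) ⊔ 0)
      (fun j _ => le_sup_right) (Finset.mem_univ j)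
  refine ⟨C, Finset.sum_nonneg fun j _ => le_sup_right, fun B hB hxB l => ?_⟩
  have hu : ∀ j, u j ∈ L C := fun j =>
    (mem_L_iff (u.ne_zero j)).2 (le_sup_left.trans (hC j))
  have hmem : ∀ q : Fin (l + 1) × Fin (finrank K⟮x⟯ F),
      x ^ (q.1 : ℕ) * u q.2 ∈ L (l • B + C) := fun q =>
    mul_mem_L (L_mono (nsmul_le_nsmul_left hB (Nat.lt_succ_iff.1 q.1.2))
      (pow_mem_L hxB q.1)) (hu q.2)
  have hli : LinearIndependent K (fun q : Fin (l + 1) × Fin (finrank K⟮x⟯ F) =>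
      x ^ (q.1 : ℕ) * u q.2) :=
    (linearIndependent_pow_mul hx u.linearIndependent).comp
      (fun q : Fin (l + 1) × Fin (finrank K⟮x⟯ F) => ((q.1 : ℕ), q.2))
      (Fin.val_injective.prodMap Function.injective_id)
  have hli' : LinearIndependent K (fun q : Fin (l + 1) × Fin (finrank K⟮x⟯ F) =>
      (⟨_, hmem q⟩ : L (l • B + C))) := LinearIndependent.of_comp (L (l • B + C)).subtype hli
  simpa using hli'.fintype_card_le_finrank

theorem mem_L_neg_div_sup_zero {x : F} (hx : x ≠ 0) : x ∈ L ((-div (K := K) x) ⊔ 0) :=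
  (mem_L_iff hx).2 le_sup_left

/-- The space L(lB + C) has dimension at least (l+1)[F : K(x)] and at most l·deg B + deg C + 1.
Comparing growth in l gives the bound; l = deg C + 1 is already large enough. -/
theorem finrank_le_degree_poles {x : F} (hx : Transcendental K x) :
    (finrank K⟮x⟯ F : ℤ) ≤ degree ((-div (K := K) x) ⊔ 0) := by
  have hx0 : x ≠ 0 := fun h => hx (h ▸ isAlgebraic_zero)
  obtain ⟨C, hC, h⟩ := exists_mul_finrank_le hx
  set B := (-div (K := K) x) ⊔ 0
  have hB : 0 ≤ B := le_sup_right
  by_contra! hlt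
  have hdC := degree_nonneg hC
  have h1 := h B hB (mem_L_neg_div_sup_zero hx0) ((degree C).toNat + 1)
  have h2 := finrank_L_le (add_nonneg (nsmul_nonneg hB ((degree C).toNat + 1)) hC)
  rw [degree_add, degree_nsmul] at h2
  have h3 : (((degree C).toNat + 1 + 1 : ℕ) : ℤ) * finrank K⟮x⟯ F ≤
      ((degree C).toNat + 1 : ℕ) * degree B + degree C + 1 := by
    refine le_trans ?_ h2
    exact_mod_cast h1
  push_cast at h3
  rw [Int.toNat_of_nonneg hdC] at h3
  have h4 : (degree C + 1 + 1) * (degree B + 1) ≤ (degree C + 1 + 1) * (finrank K⟮x⟯ F : ℤ) :=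
    mul_le_mul_of_nonneg_left hlt (by omega)
  have hdB := degree_nonneg hB
  linarith

theorem degree_zeros_le_finrank {x : F} (hx : Transcendental K x) :
    degree (div (K := K) x ⊔ 0) ≤ finrank K⟮x⟯ F := by
  have hx0 : x ≠ 0 := fun h => hx (h ▸ isAlgebraic_zero)
  set Z := div (K := K) x ⊔ 0 with hZ
  have h := (Place.sum_mul_degree_le (ι := Z.support) hx (P := fun P => (P : Place K F))
    Subtype.val_injective (fun P => (Z P).toNat) (fun P => by
      have hP : 0 < Z P := lt_of_le_of_ne ((le_sup_right : 0 ≤ Z) P)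
        (Finsupp.mem_support_iff.1 P.2).symm
      have hP' : Z P = div x (P : Place K F) := by
        have h1 : Z P = div x (P : Place K F) ⊔ 0 := rfl
        omega
      rw [Int.toNat_of_nonneg hP.le, hP', ← val_eq_exp_neg_div hx0])).2
  refine le_trans (le_of_eq ?_) (Int.ofNat_le.2 h)
  rw [degree, Finsupp.sum, Nat.cast_sum, ← Finset.sum_coe_sort]
  refine Finset.sum_congr rfl fun P _ => ?_
  rw [Nat.cast_mul, Int.toNat_of_nonneg ((le_sup_right : 0 ≤ Z) P)]

/-- The index [F : K(x)] is squeezed in: degree of zeros ≤ [F : K(x)] ≤ degree of poles. Applying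
this to the inverse of x as well gives degree 0. -/
theorem degree_div_nonpos (x : F) : degree (div (K := K) x) ≤ 0 := by
  by_cases hx : Transcendental K x
  · have h := (degree_zeros_le_finrank hx).trans (finrank_le_degree_poles hx)
    have h1 : div (K := K) x = (div x ⊔ 0) - ((-div x) ⊔ 0) := by
      ext P
      simp only [Finsupp.sub_apply, Finsupp.sup_apply, Finsupp.neg_apply, Finsupp.zero_apply]
      omega
    rw [h1, degree_sub]
    omega
  · have : div (K := K) x = 0 := by
      ext P
      by_contra hP
      by_cases hx0 : x = 0
      · exact hP (by rw [hx0]; simp [div_apply])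
      · refine hx (P.transcendental_of_val_ne_one hx0 fun h => hP ?_)
        rw [div_apply, h]; simp
    rw [this, degree_zero]

/-- Principal divisors have degree zero. -/
theorem degree_div (x : F) : degree (div (K := K) x) = 0 := by
  refine le_antisymm (degree_div_nonpos x) ?_
  have := degree_div_nonpos (K := K) x⁻¹
  rw [div_inv, degree_neg] at this
  omega

theorem eq_zero_of_mem_L {A : Divisor K F} (hA : degree A < 0) {f : F} (hf : f ∈ L A) : f = 0 := by
  by_contra h0
  have h := degree_mono ((mem_L_iff h0).1 hf)
  rw [degree_neg, degree_div] at h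
  omega

theorem finrank_L_sub_div_le (A : Divisor K F) {z : F} (hz : z ≠ 0) :
    finrank K (L (A - div z)) ≤ finrank K (L A) := by
  let m : L (A - div z) →ₗ[K] L A :=
    { toFun := fun f => ⟨f * z⁻¹, by
        have h := mul_mem_L f.2 ((mem_L_iff (A := div z) (inv_ne_zero hz)).2
          (by rw [div_inv, neg_neg]))
        rwa [sub_add_cancel] at h⟩
      map_add' := fun f g => Subtype.ext (add_mul _ _ _)
      map_smul' := fun a f => Subtype.ext (smul_mul_assoc _ _ _) }
  refine LinearMap.finrank_le_finrank_of_injective (f := m) fun f g h => Subtype.ext ?_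
  have : (f : F) * z⁻¹ = g * z⁻¹ := congrArg Subtype.val h
  exact mul_right_cancel₀ (inv_ne_zero hz) this

end Principal

/-! ### Riemann's theorem and inequality -/

section Riemann

/-- Riemann's theorem. -/
theorem exists_degree_sub_finrank_le :
    ∃ γ : ℤ, ∀ A : Divisor K F, degree A - (finrank K (L A) : ℤ) ≤ γ := by
  obtain ⟨x, hx⟩ := IsAlgFunctionField.exists_transcendental (K := K) (F := F)
  have hx0 : x ≠ 0 := fun h => hx (h ▸ isAlgebraic_zero)
  have := IsAlgFunctionField.finiteDimensional_adjoin x hx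
  obtain ⟨C, hC, h⟩ := exists_mul_finrank_le hx
  set B := (-div (K := K) x) ⊔ 0 with hBdef
  have hB : 0 ≤ B := le_sup_right
  obtain ⟨n, hn⟩ : ∃ n : ℤ, n = finrank K⟮x⟯ F := ⟨_, rfl⟩
  have hn1 : 1 ≤ n := by
    have : 0 < finrank K⟮x⟯ F := finrank_pos
    omega
  have hdB : degree B ≤ n := by
    have h1 : B = (div x ⊔ 0) - div x := by
      ext P
      simp only [hBdef, Finsupp.sub_apply, Finsupp.sup_apply, Finsupp.neg_apply,
        Finsupp.zero_apply]
      omega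
    rw [h1, degree_sub, degree_div, sub_zero, hn]
    exact degree_zeros_le_finrank hx
  have hlB : ∀ l : ℕ, (l + 1) * n - degree C ≤ finrank K (L (l • B)) := by
    intro l
    have h1 := (finrank_L_add_le hC (l • B) inferInstance).2
    have h2 : ((l : ℤ) + 1) * n ≤ finrank K (L (l • B + C)) := by
      rw [hn]
      exact_mod_cast h B hB (mem_L_neg_div_sup_zero hx0) l
    linarith
  refine ⟨degree C - n, fun A => ?_⟩
  have hA1 : (0 : Divisor K F) ≤ A ⊔ 0 := le_sup_right
  have hdA1 := degree_nonneg hA1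
  have hdC := degree_nonneg hC
  -- With this l the space L(lB - A⁺), A⁺ = A ⊔ 0, has dimension at least (l+1)n - deg C - deg A⁺ ≥
  -- n > 0. A nonzero z in it gives A⁺ - div z ≤ lB. Since deg - dim is monotone, the bound known
  -- for lB passes to A⁺ - div z, then to A⁺ and A.
  set l : ℕ := (degree C + degree (A ⊔ 0)).toNat with hl
  have hlz : (l : ℤ) = degree C + degree (A ⊔ 0) := Int.toNat_of_nonneg (by omega)
  have hpos : 0 < finrank K (L (l • B - (A ⊔ 0))) := by
    have h1 := (finrank_L_add_le hA1 (l • B - (A ⊔ 0)) inferInstance).2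
    rw [sub_add_cancel] at h1
    have h2 := hlB l
    have h3 : (l : ℤ) * 1 ≤ l * n := mul_le_mul_of_nonneg_left hn1 (Int.natCast_nonneg l)
    have h4 : ((l : ℤ) + 1) * n = l * n + n := by ring
    omega
  have hnt := Module.nontrivial_of_finrank_pos hpos
  obtain ⟨z, hz⟩ := exists_ne (0 : L (l • B - (A ⊔ 0)))
  have hz0 : (z : F) ≠ 0 := fun h => hz (Subtype.ext h)
  have hle : (A ⊔ 0) - div (z : F) ≤ l • B := by
    have := (mem_L_iff hz0).1 z.2
    have h2 := add_le_add_right this (A ⊔ 0)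
    rw [sub_eq_add_neg]
    simpa using h2
  have e1 := finrank_L_sub_degree_anti (le_sup_left : A ≤ A ⊔ 0)
  have e2 := finrank_L_sub_degree_anti hle
  have e3 := finrank_L_sub_div_le (A ⊔ 0) hz0
  have e4 := hlB l
  rw [degree_sub, degree_div, degree_nsmul] at e2
  have e5 : (l : ℤ) * degree B ≤ l * n := mul_le_mul_of_nonneg_left hdB (Int.natCast_nonneg l)
  have e6 : ((l : ℤ) + 1) * n = l * n + n := by ring
  omega

/-- Riemann's inequality. -/
theorem degree_add_one_sub_genus_le (A : Divisor K F) :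
    degree A + 1 - genus K F ≤ finrank K (L A) := by
  obtain ⟨γ, hγ⟩ := exists_degree_sub_finrank_le (K := K) (F := F)
  have h : degree A - (finrank K (L A) : ℤ) + 1 ≤ genus K F :=
    -- Boundedness is needed here: the supremum of an unbounded set of integers has a default value
    -- and would bound nothing.
    le_csSup ⟨γ + 1, by rintro _ ⟨B, rfl⟩; have := hγ B; dsimp only; omega⟩ ⟨A, rfl⟩
  omega

end Riemann

end Divisor

/-! ### Expansions and multiplicities at rational places -/

namespace Place

section Rational

variable {P : Place K F}

theorem IsRational.bijective_algebraMap (hP : P.IsRational) :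
    Function.Bijective (algebraMap K (IsLocalRing.ResidueField P.ring)) := by
  refine ⟨(algebraMap K _).injective, fun c => ?_⟩
  obtain ⟨a, ha⟩ := (finrank_eq_one_iff_of_nonzero' (1 : IsLocalRing.ResidueField P.ring)
    one_ne_zero).1 hP c
  exact ⟨a, by rw [← ha, Algebra.smul_def, mul_one]⟩

theorem val_coe_le_exp_neg_one {f : P.ring} (hf : IsLocalRing.residue P.ring f = 0) :
    P.val (f : F) ≤ WithZero.exp (-1 : ℤ) := by
  rw [IsLocalRing.residue_eq_zero_iff, ← P.val_coe_lt_one_iff] at hf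
  rcases eq_or_ne (P.val (f : F)) 0 with h0 | h0
  · simp [h0]
  · rw [← WithZero.exp_zero, ← WithZero.log_lt_iff_lt_exp h0] at hf
    rw [← WithZero.log_le_iff_le_exp h0]
    omega

theorem IsRational.val_sub_eval_le (hP : P.IsRational) {f : F} (hf : f ∈ P.ring) :
    P.val (f - algebraMap K F (P.eval f)) ≤ WithZero.exp (-1 : ℤ) := by
  refine val_coe_le_exp_neg_one (f := ⟨f, hf⟩ - algebraMap K P.ring (P.eval f)) ?_
  rw [map_sub, eval, dif_pos hf, sub_eq_zero]
  exact (Function.rightInverse_invFun hP.bijective_algebraMap.2 _).symm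

theorem IsRational.exists_expansion (hP : P.IsRational) {φ : F} (hφ : P.IsLocalParameter φ)
    {f : F} (hf : f ∈ P.ring) :
    ∃ c : ℕ → K, ∀ N : ℕ, P.val (f - ∑ a ∈ Finset.range N, algebraMap K F (c a) * φ ^ a) ≤
      WithZero.exp (-(N : ℤ)) := by
  let e := LinearEquiv.ofBijective
    (Algebra.linearMap K (IsLocalRing.ResidueField P.ring)) hP.bijective_algebraMap
  let σ : IsLocalRing.ResidueField P.ring →ₗ[K] P.ring :=
    Algebra.linearMap K P.ring ∘ₗ e.symm.toLinearMap
  have hσ : ∀ c, IsLocalRing.residue P.ring (σ c) = c := fun c => e.apply_symm_apply c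
  obtain ⟨d, hd, -, -⟩ := exists_digits (K := K) (φ := (⟨φ, hφ.mem_ring⟩ : P.ring))
    (fun h => hφ.ne_zero (congrArg Subtype.val h)) hφ.maximalIdeal_eq σ hσ
  refine ⟨fun a => e.symm (d ⟨f, hf⟩ a), fun N => ?_⟩
  obtain ⟨g, hg⟩ := hd ⟨f, hf⟩ N
  rw [hφ.val_le_exp_neg_iff]
  refine ⟨g, g.2, ?_⟩
  have h := congrArg (fun z : P.ring => (z : F)) hg
  rw [sub_eq_iff_eq_add']
  refine h.trans ?_
  push_cast
  rfl

/-- The first nonzero term c_a φ^a would force f to have valuation exactly a. -/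
theorem eq_zero_of_expansion {φ : F} (hφ : P.IsLocalParameter φ) {f : F} {c : ℕ → K}
    (hc : ∀ N : ℕ, P.val (f - ∑ a ∈ Finset.range N, algebraMap K F (c a) * φ ^ a) ≤
      WithZero.exp (-(N : ℤ))) {M : ℕ} (hM : P.val f ≤ WithZero.exp (-(M : ℤ))) :
    ∀ a < M, c a = 0 := by
  intro a
  induction a using Nat.strong_induction_on with
  | _ a ih =>
    intro ha
    by_contra hca
    have h := hc (a + 1)
    rw [Finset.sum_range_succ, Finset.sum_eq_zero (s := Finset.range a), zero_add] at h
    · have h1 : P.val f ≤ WithZero.exp (-((a + 1 : ℕ) : ℤ)) :=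
        hM.trans (WithZero.exp_le_exp.2 (by omega))
      have h2 := P.val.map_sub_le h1 h
      rw [sub_sub_cancel, map_mul, P.val_algebraMap hca, one_mul, hφ.val_pow,
        WithZero.exp_le_exp] at h2
      omega
    · intro i hi
      have hi := Finset.mem_range.1 hi
      rw [ih i hi (by omega), map_zero, zero_mul]

theorem eq_zero_of_val_le {f : F} (h : ∀ N : ℕ, P.val f ≤ WithZero.exp (-(N : ℤ))) : f = 0 := by
  by_contra h0
  have h1 : P.val f ≠ 0 := by simpa using h0
  have h2 := h ((-WithZero.log (P.val f)).toNat + 1)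
  rw [← WithZero.log_le_iff_le_exp h1] at h2
  omega

end Rational

section Multiplicity

variable {P : Place K F}

/-- The exact multiplicity is the least a + b with a nonzero coefficient. It exists because a
polynomial all of whose expansions vanish is zero. Together with the converse below, this turns
multiplicity into valuation bounds on Taylor coefficients. -/
theorem IsRational.hasZeroOfMultiplicityAtLeast (hP : P.IsRational) {r : K} {Q : F[X]} {m : ℕ}
    (hQ : Q ≠ 0) (h : ∀ b, P.val ((Polynomial.taylor (algebraMap K F r) Q).coeff b) ≤
      WithZero.exp (-((m - b : ℕ) : ℤ))) :
    P.HasZeroOfMultiplicityAtLeast r Q m := by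
  obtain ⟨φ, hφ⟩ := P.exists_isLocalParameter
  have hmem : ∀ b, (Polynomial.taylor (algebraMap K F r) Q).coeff b ∈ P.ring := fun b => by
    rw [← P.val_le_one_iff, ← WithZero.exp_zero]
    exact (h b).trans (WithZero.exp_le_exp.2 (by omega))
  choose c hc using fun b => hP.exists_expansion hφ (hmem b)
  have hne : ∃ k, ∃ a ≤ k, c (k - a) a ≠ 0 := by
    by_contra! hall
    refine hQ (Polynomial.taylor_injective (algebraMap K F r) ?_)
    rw [map_zero]
    ext b
    rw [Polynomial.coeff_zero]
    refine eq_zero_of_val_le (P := P) fun N => ?_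
    have hN := hc b N
    rwa [Finset.sum_eq_zero, sub_zero] at hN
    intro a _
    have hab := hall (a + b) a (by omega)
    rw [Nat.add_sub_cancel_left] at hab
    rw [hab, map_zero, zero_mul]
  classical
  have hlt : ∀ a b, a + b < Nat.find hne → c b a = 0 := fun a b hab => by
    by_contra h0
    exact Nat.find_min hne hab ⟨a, by omega, by rwa [Nat.add_sub_cancel_left]⟩
  refine ⟨Nat.find hne, ?_, φ, fun a b => c b a, hφ, fun b N => hc b N, hlt, Nat.find_spec hne⟩
  by_contra! hm
  obtain ⟨a, ha, hca⟩ := Nat.find_spec hne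
  exact hca (eq_zero_of_expansion hφ (hc _) (h _) a (by omega))

theorem HasZeroOfMultiplicityAtLeast.val_taylor_coeff_le {r : K} {Q : F[X]} {m : ℕ}
    (h : P.HasZeroOfMultiplicityAtLeast r Q m) (b : ℕ) :
    P.val ((Polynomial.taylor (algebraMap K F r) Q).coeff b) ≤
      WithZero.exp (-((m - b : ℕ) : ℤ)) := by
  obtain ⟨m', hm', φ, c, -, hexp, hc, -⟩ := h
  have h1 := hexp b (m' - b)
  rw [Finset.sum_eq_zero, sub_zero] at h1
  · exact h1.trans (WithZero.exp_le_exp.2 (by omega))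
  · intro a ha
    have ha := Finset.mem_range.1 ha
    rw [hc a b (by omega), map_zero, zero_mul]

theorem val_natCast_le_one (P : Place K F) (k : ℕ) : P.val (k : F) ≤ 1 := by
  simpa using P.val_algebraMap_le_one (k : K)

/-- Moving the centre of expansion of a polynomial by `δ`. -/
theorem val_coeff_taylor_le {S : F[X]} {δ : F} {m s : ℕ}
    (hS : ∀ k, P.val (S.coeff k) ≤ WithZero.exp (-((m * (s - k) : ℕ) : ℤ)))
    (hδ : P.val δ ≤ WithZero.exp (-(m : ℤ))) (b : ℕ) :
    P.val ((Polynomial.taylor δ S).coeff b) ≤ WithZero.exp (-((m * (s - b) : ℕ) : ℤ)) := by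
  rw [Polynomial.taylor_coeff, Polynomial.eval_eq_sum]
  -- The b-th new coefficient is a sum of integer multiples of S_(k+b) δ^k, of order at least
  -- m(s-k-b) + mk ≥ m(s-b). Truncated subtraction only strengthens this.
  refine P.val.map_sum_le fun k _ => ?_
  rw [Polynomial.hasseDeriv_coeff, map_mul, map_mul, map_pow]
  have h1 : P.val δ ^ k ≤ WithZero.exp (-((m * k : ℕ) : ℤ)) := by
    refine (pow_le_pow_left' hδ k).trans_eq ?_
    rw [← WithZero.exp_nsmul]
    congr 1
    simp; ring
  calc _ ≤ 1 * WithZero.exp (-((m * (s - (k + b)) : ℕ) : ℤ)) * WithZero.exp (-((m * k : ℕ) : ℤ)) :=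
        mul_le_mul' (mul_le_mul' (P.val_natCast_le_one _) (hS _)) h1
    _ = WithZero.exp (-((m * (s - (k + b)) : ℕ) : ℤ) + -((m * k : ℕ) : ℤ)) := by
        rw [one_mul, WithZero.exp_add]
    _ ≤ _ := by
        rw [WithZero.exp_le_exp, ← neg_add, neg_le_neg_iff, ← Nat.cast_add, ← mul_add]
        exact_mod_cast Nat.mul_le_mul_left m (by omega)

theorem HasZeroOfMultiplicityAtLeast.val_eval_le {r : K} {Q : F[X]} {m : ℕ}
    (h : P.HasZeroOfMultiplicityAtLeast r Q m) {f : F}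
    (hf : P.val (f - algebraMap K F r) ≤ WithZero.exp (-1 : ℤ)) :
    P.val (Q.eval f) ≤ WithZero.exp (-(m : ℤ)) := by
  -- Q(f) is the constant Taylor coefficient at f, obtained from the expansion at r by the shift f -
  -- r of order at least 1.
  have h1 := val_coeff_taylor_le (m := 1) (s := m) (fun k => by
    simpa only [one_mul] using h.val_taylor_coeff_le k) (by simpa only [Nat.cast_one] using hf) 0
  rwa [Polynomial.taylor_taylor, Polynomial.taylor_coeff_zero, sub_add_cancel, one_mul,
    Nat.sub_zero] at h1

end Multiplicity

/-- Imposing `∑ N` linear conditions at rational places on a space of larger dimension. -/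
theorem exists_ne_zero_of_sum_lt {U ι : Type*} [AddCommGroup U] [Module K U] [Module.Finite K U]
    [Fintype ι] (P : ι → Place K F) (hP : ∀ i, (P i).IsRational) (g : ι → U →ₗ[K] F)
    (hg : ∀ i u, g i u ∈ (P i).ring) (N : ι → ℕ) (hN : ∑ i, N i < finrank K U) :
    ∃ u : U, u ≠ 0 ∧ ∀ i, (P i).val (g i u) ≤ WithZero.exp (-(N i : ℤ)) := by
  choose T _ hT using fun i => (P i).exists_truncation (N i)
  let ev : ∀ i, U →ₗ[K] (P i).ring := fun i =>
    { toFun := fun u => ⟨g i u, hg i u⟩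
      map_add' := fun u v => Subtype.ext (map_add _ _ _)
      map_smul' := fun a u => Subtype.ext ((map_smul _ _ _).trans (Algebra.smul_def _ _)) }
  let Φ : U →ₗ[K] (∀ i, Fin (N i) → IsLocalRing.ResidueField (P i).ring) :=
    LinearMap.pi fun i => T i ∘ₗ ev i
  have hfin : ∀ i, Module.Finite K (IsLocalRing.ResidueField (P i).ring) := fun i =>
    Module.finite_of_finrank_eq_succ (hP i)
  have hdim : finrank K (∀ i, Fin (N i) → IsLocalRing.ResidueField (P i).ring) = ∑ i, N i := by
    rw [finrank_pi_fin N _ fun i _ => hfin i]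
    refine Finset.sum_congr rfl fun i _ => ?_
    rw [show finrank K (IsLocalRing.ResidueField (P i).ring) = 1 from hP i, mul_one]
  have hker : LinearMap.ker Φ ≠ ⊥ := by
    intro hbot
    have h1 := LinearMap.finrank_le_finrank_of_injective (LinearMap.ker_eq_bot.1 hbot)
    omega
  obtain ⟨u, hu, hu0⟩ := Submodule.exists_mem_ne_zero_of_ne_bot hker
  exact ⟨u, hu0, fun i => (hT i (ev i u)).1 (congrFun hu i)⟩

end Place

/-! ### Taylor expansion in characteristic p -/

section Taylor

/-- In characteristic `p`, the Taylor expansion of `R(z ^ m)` for `m = p ^ e`. -/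
theorem taylor_expand_pow_char (p e : ℕ) [ExpChar F p] (r : F) (R : F[X]) :
    Polynomial.taylor r (Polynomial.expand F (p ^ e) R) =
      Polynomial.expand F (p ^ e) (Polynomial.taylor (r ^ p ^ e) R) := by
  rw [Polynomial.taylor_apply, Polynomial.taylor_apply, Polynomial.expand_eq_comp_X_pow,
    Polynomial.expand_eq_comp_X_pow, Polynomial.comp_assoc, Polynomial.comp_assoc]
  congr 1
  simp [add_pow_expChar_pow]

theorem taylor_sum_X_sub_C_pow (a : F) {N : ℕ} (t : ℕ) (B : Fin N → F) :
    Polynomial.taylor a (∑ j, Polynomial.C (B j) * (Polynomial.X - Polynomial.C a) ^ (t + j)) =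
      ∑ j, Polynomial.C (B j) * Polynomial.X ^ (t + j : ℕ) := by
  rw [map_sum]
  simp [Polynomial.taylor_mul, Polynomial.taylor_pow]

end Taylor

/-! ### Roots of interpolation polynomials -/

section Roots

theorem sum_C_mul_X_pow_eq_expand (m ℓ : ℕ) (q : ℕ → F) :
    ∑ j ∈ Finset.range (ℓ + 1), Polynomial.C (q j) * Polynomial.X ^ (m * j) =
      Polynomial.expand F m
        (∑ j ∈ Finset.range (ℓ + 1), Polynomial.C (q j) * Polynomial.X ^ j) := by
  simp [map_sum, ← pow_mul]

theorem encard_setOf_isRoot_le (p e ℓ : ℕ) [ExpChar F p] (q : ℕ → F) {Q : F[X]} (hQ0 : Q ≠ 0)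
    (hQ : Q = ∑ j ∈ Finset.range (ℓ + 1), Polynomial.C (q j) * Polynomial.X ^ (p ^ e * j)) :
    {x : F | Q.IsRoot x}.encard ≤ ℓ := by
  rw [sum_C_mul_X_pow_eq_expand] at hQ
  set R := ∑ j ∈ Finset.range (ℓ + 1), Polynomial.C (q j) * Polynomial.X ^ j with hR
  have hR0 : R ≠ 0 := fun h => hQ0 (by rw [hQ, h, map_zero])
  have hdeg : R.natDegree ≤ ℓ := by
    refine Polynomial.natDegree_sum_le_of_forall_le _ _ fun j hj => ?_
    have := Finset.mem_range.1 hj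
    exact (Polynomial.natDegree_C_mul_X_pow_le _ _).trans (by omega)
  classical
  have hmaps : Set.MapsTo (fun x : F => x ^ p ^ e) {x : F | Q.IsRoot x}
      (R.roots.toFinset : Set F) := by
    intro x hx
    have hx' : Q.eval x = 0 := hx
    rw [hQ, Polynomial.expand_eval] at hx'
    simpa [hR0] using hx'
  have hinj : Function.Injective (fun x : F => x ^ p ^ e) := iterateFrobenius_inj F p e
  refine (Set.encard_le_encard_of_injOn hmaps hinj.injOn).trans ?_
  rw [Set.encard_coe_eq_coe_finsetCard]
  exact_mod_cast (Multiset.toFinset_card_le _).trans ((Polynomial.card_roots' R).trans hdeg)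

end Roots

namespace Divisor

theorem apply_eq_zero_of_disjoint {n : ℕ} {P : Fin n → Place K F} {A : Divisor K F}
    (h : Disjoint A.support (ofPoints P).support) (i : Fin n) : A (P i) = 0 := by
  rw [← Finsupp.notMem_support_iff]
  refine Finset.disjoint_right.1 h ?_
  classical
  rw [Finsupp.mem_support_iff, ofPoints, Finsupp.finsetSum_apply]
  refine ne_of_gt (lt_of_lt_of_le zero_lt_one ?_)
  have h1 := Finset.single_le_sum (f := fun j => (Finsupp.single (P j) (1 : ℤ)) (P i))
    (fun j _ => by rw [Finsupp.single_apply]; split_ifs <;> norm_num) (Finset.mem_univ i)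
  simpa using h1

theorem mem_ring_of_mem_L {A : Divisor K F} {P : Place K F} (hA : A P = 0) {f : F}
    (hf : f ∈ L A) : f ∈ P.ring := by
  rw [← P.val_le_one_iff]
  simpa [hA] using hf P

end Divisor

open Divisor

/-- An interpolation polynomial vanishes at `f` if there are enough correct positions. -/
theorem isRoot_of_isInterpolationPolynomial [IsAlgFunctionField K F] {p e s ℓ n : ℕ}
    {P : Fin n → Place K F} (hPinj : Function.Injective P) (hPrat : ∀ i, (P i).IsRational)
    {G A : Divisor K F} (hG : ∀ i, G (P i) = 0) (hA : ∀ i, A (P i) = 0) {f : F} (hf : f ∈ L G)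
    {r : Fin n → K} {I : Finset (Fin n)} (hI : ∀ i ∈ I, r i = (P i).eval f)
    (hdeg : degree A < (p : ℤ) ^ e * s * I.card) {Q : F[X]}
    (hQ : IsInterpolationPolynomial p e s ℓ P r G A Q) : Q.IsRoot f := by
  classical
  obtain ⟨-, ⟨q, hQq, hq⟩, hmult⟩ := hQ
  have hAmem : Q.eval f ∈ L A := by
    rw [hQq, Polynomial.eval_finsetSum]
    refine Submodule.sum_mem _ fun j hj => ?_
    have hj := Finset.mem_range.1 hj
    have h := mul_mem_L (hq j (by omega)) (pow_mem_L hf (p ^ e * j))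
    rw [sub_add_cancel] at h
    simpa using h
  have hval : ∀ i ∈ I, (P i).val (Q.eval f) ≤ WithZero.exp (-((p ^ e * s : ℕ) : ℤ)) := by
    intro i hi
    refine (hmult i).val_eval_le ?_
    rw [hI i hi]
    exact (hPrat i).val_sub_eval_le (mem_ring_of_mem_L (hG i) hf)
  have hsum : ∀ R : Place K F, R ∉ I.image P →
      (∑ i ∈ I, Finsupp.single (P i) ((p ^ e * s : ℕ) : ℤ)) R = 0 := by
    intro R hR
    rw [Finsupp.finsetSum_apply]
    refine Finset.sum_eq_zero fun i hi => Finsupp.single_eq_of_ne fun h => hR ?_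
    exact Finset.mem_image.2 ⟨i, hi, h.symm⟩
  -- As A vanishes at the P_i, the membership of Q(f) in L(A) and its zeros at the positions in I
  -- combine to membership in L(A - p^e s ∑ P_i), of negative degree.
  refine eq_zero_of_mem_L
    (A := A - ∑ i ∈ I, Finsupp.single (P i) ((p ^ e * s : ℕ) : ℤ)) ?_ fun R => ?_
  · rw [degree_sub, degree_sum]
    have : ∀ i ∈ I, degree (Finsupp.single (P i) ((p ^ e * s : ℕ) : ℤ)) = (p : ℤ) ^ e * s := by
      intro i _
      rw [degree_single, show (P i).degree = 1 from hPrat i]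
      push_cast
      ring
    rw [Finset.sum_congr rfl this, Finset.sum_const, nsmul_eq_mul]
    linarith
  · by_cases hR : R ∈ I.image P
    · obtain ⟨i, hi, rfl⟩ := Finset.mem_image.1 hR
      refine (hval i hi).trans_eq ?_
      rw [Finsupp.sub_apply, hA i, Finsupp.finsetSum_apply, Finset.sum_eq_single_of_mem i hi,
        Finsupp.single_eq_same, zero_sub]
      exact fun j _ hj => Finsupp.single_eq_of_ne fun h => hj (hPinj h).symm
    · rw [Finsupp.sub_apply, hsum R hR, sub_zero]
      exact hAmem R

/-! ### Counting unknowns and conditions -/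

section Counting

theorem sum_range_sub (s : ℕ) : ∑ b ∈ Finset.range s, (s - b) = (s + 1).choose 2 := by
  induction s with
  | zero => rfl
  | succ s ih =>
    rw [Finset.sum_range_succ']
    simp only [Nat.add_sub_add_right, Nat.sub_zero]
    rw [ih, Nat.choose_succ_succ (s + 1) 1, Nat.choose_one_right, add_comm]

theorem sum_range_ite_sub (t u : ℕ) :
    ∑ b ∈ Finset.range (t + u), (if b < t then 0 else t + u - b) = (u + 1).choose 2 := by
  induction t with
  | zero => simpa using sum_range_sub u
  | succ t ih =>
    rw [show t + 1 + u = t + u + 1 by ring, Finset.sum_range_succ']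
    simpa using ih

theorem sum_fin_add (t k : ℕ) :
    ∑ j : Fin (k + 1), ((t : ℚ) + (j : ℕ)) = ((t + k + 1).choose 2 : ℚ) - (t.choose 2 : ℚ) := by
  rw [Fin.sum_univ_eq_sum_range (fun j => (t : ℚ) + (j : ℕ)) (k + 1)]
  induction k with
  | zero =>
    rw [Nat.cast_choose_two, Nat.cast_choose_two]
    simp
    ring
  | succ k ih =>
    rw [Finset.sum_range_succ, ih, Nat.cast_choose_two, Nat.cast_choose_two, Nat.cast_choose_two]
    push_cast
    ring

/-- The count of unknowns against the count of conditions. -/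
theorem count_lt (p e n t u k τ : ℕ) (hp : 0 < p) (hs : 1 ≤ t + u) (d D g : ℤ)
    (hd : d < (p : ℤ) ^ e * (t + u : ℕ) * ((n : ℤ) - τ))
    (h : (p : ℚ) ^ e * (t + u : ℕ) * ((n : ℚ) - radius p e n (t + u) (t + k) t D g) - 1 ≤ d) :
    ((τ : ℤ) * (p ^ e * (t + u + 1).choose 2 : ℕ) + ((n : ℤ) - τ) * (p ^ e * (u + 1).choose 2 : ℕ))
      < ∑ j : Fin (k + 1), (d - (p ^ e * (t + j) : ℕ) * D + 1 - g) := by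
  have hm : (0 : ℚ) < (p : ℚ) ^ e := by positivity
  have hsQ : (1 : ℚ) ≤ ((t + u : ℕ) : ℚ) := by exact_mod_cast hs
  have hd' : (d : ℚ) + 1 ≤ (p : ℚ) ^ e * (t + u : ℕ) * ((n : ℚ) - τ) := by exact_mod_cast hd
  rw [radius, show t + u - t + 1 = u + 1 by omega] at h
  have hcc : ((u + 1).choose 2 : ℚ) ≤ ((t + u + 1).choose 2 : ℚ) := by
    exact_mod_cast Nat.choose_le_choose 2 (by omega)
  have hsum : ((∑ j : Fin (k + 1), (d - (p ^ e * (t + j) : ℕ) * D + 1 - g) : ℤ) : ℚ) =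
      ((k : ℚ) + 1) * (d + 1 - g) -
        (p : ℚ) ^ e * (((t + k + 1).choose 2 : ℚ) - (t.choose 2 : ℚ)) * D := by
    rw [← sum_fin_add, Finset.mul_sum, Finset.sum_mul]
    push_cast
    simp only [Finset.sum_sub_distrib, Finset.sum_add_distrib, Finset.sum_const,
      Finset.card_univ, Fintype.card_fin, nsmul_eq_mul]
    push_cast
    ring
  have hgoal : (((τ : ℤ) * (p ^ e * (t + u + 1).choose 2 : ℕ) +
      ((n : ℤ) - τ) * (p ^ e * (u + 1).choose 2 : ℕ) : ℤ) : ℚ)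
      < ((∑ j : Fin (k + 1), (d - (p ^ e * (t + j) : ℕ) * D + 1 - g) : ℤ) : ℚ) := by
    rw [hsum]
    push_cast
    generalize ((t + u + 1).choose 2 : ℚ) = cs at *
    generalize ((u + 1).choose 2 : ℚ) = cu at *
    generalize (((t + k + 1).choose 2 : ℕ) : ℚ) - ((t.choose 2 : ℕ) : ℚ) = σ at *
    generalize (p : ℚ) ^ e = m at *
    have hk : ((t + k : ℕ) : ℚ) - t + 1 = k + 1 := by push_cast; ring
    rw [hk] at h
    generalize ((t + u : ℕ) : ℚ) = s at *
    have hN : 0 < cs + s * ((k : ℚ) + 1) - cu := by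
      have : 0 < s * ((k : ℚ) + 1) := by positivity
      linarith
    set N := cs + s * ((k : ℚ) + 1) - cu with hNdef
    -- Here s = t + u, ℓ = t + k, and N is the denominator of the radius; `cs` and `cu` are the
    -- costs of an error and of a correct position, divided by m.
    have h1 : m * s * ((n : ℚ) - ((n * (s * (k + 1) - cu) - σ * D) / N
        - (1 + g * (k + 1)) / (m * N))) * N
        = s * (m * n * cs + m * σ * D + 1 + g * (k + 1)) := by
      field_simp
      rw [hNdef]
      ring
    have h2 : s * (m * n * cs + m * σ * D + 1 + g * (k + 1)) ≤ (d + 1) * N := by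
      rw [← h1]
      exact mul_le_mul_of_nonneg_right (by linarith) hN.le
    -- The integral bound d + 1 ≤ ms(n - τ) absorbs the part (d+1)(cs - cu) of (d+1)N. What remains
    -- is divisible by s, and the 1 in 1 + g(k+1) makes the final inequality strict.
    have h3 : (d + 1) * (cs - cu) ≤ m * s * ((n : ℚ) - τ) * (cs - cu) :=
      mul_le_mul_of_nonneg_right hd' (by linarith)
    have h4 : s * (m * n * cs + m * σ * D + 1 + g * (k + 1)) ≤
        s * (m * ((n : ℚ) - τ) * (cs - cu) + (d + 1) * (k + 1)) := by
      rw [hNdef] at h2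
      linarith
    have h5 := le_of_mul_le_mul_left h4 (by linarith)
    linarith
  exact_mod_cast hgoal

end Counting

/-! ### Construction of the interpolation polynomial -/

section Existence

/-- The polynomial `∑ B_j (y - a) ^ (t + j)`. -/
def shiftedPoly (a : F) (t : ℕ) {N : ℕ} (B : Fin N → F) : F[X] :=
  ∑ j, Polynomial.C (B j) * (Polynomial.X - Polynomial.C a) ^ (t + j : ℕ)

theorem taylor_shiftedPoly (a : F) (t : ℕ) {N : ℕ} (B : Fin N → F) :
    Polynomial.taylor a (shiftedPoly a t B) =
      ∑ j, Polynomial.C (B j) * Polynomial.X ^ (t + j : ℕ) :=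
  taylor_sum_X_sub_C_pow a t B

theorem coeff_taylor_shiftedPoly_of_lt (a : F) {t : ℕ} {N : ℕ} (B : Fin N → F) {b : ℕ}
    (hb : b < t) : (Polynomial.taylor a (shiftedPoly a t B)).coeff b = 0 := by
  rw [taylor_shiftedPoly, Polynomial.finsetSum_coeff]
  refine Finset.sum_eq_zero fun j _ => ?_
  rw [Polynomial.coeff_C_mul_X_pow, if_neg (by omega)]

theorem coeff_taylor_shiftedPoly_add (a : F) (t : ℕ) {N : ℕ} (B : Fin N → F) (j : Fin N) :
    (Polynomial.taylor a (shiftedPoly a t B)).coeff (t + j) = B j := by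
  rw [taylor_shiftedPoly, Polynomial.finsetSum_coeff, Finset.sum_eq_single j]
  · rw [Polynomial.coeff_C_mul_X_pow, if_pos rfl]
  · intro i _ hi
    rw [Polynomial.coeff_C_mul_X_pow, if_neg]
    intro h
    exact hi (Fin.ext (by omega))
  · simp

theorem shiftedPoly_add (a : F) (t : ℕ) {N : ℕ} (B B' : Fin N → F) :
    shiftedPoly a t (B + B') = shiftedPoly a t B + shiftedPoly a t B' := by
  simp [shiftedPoly, add_mul, Finset.sum_add_distrib]

theorem shiftedPoly_smul (a : F) (t : ℕ) {N : ℕ} (c : K) (B : Fin N → F) :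
    shiftedPoly a t (c • B) = algebraMap K F c • shiftedPoly a t B := by
  simp [shiftedPoly, Algebra.smul_def, Finset.mul_sum, mul_assoc]

theorem natDegree_shiftedPoly_le (a : F) (t k : ℕ) (B : Fin (k + 1) → F) :
    (shiftedPoly a t B).natDegree ≤ t + k := by
  refine Polynomial.natDegree_sum_le_of_forall_le _ _ fun j _ => ?_
  refine (Polynomial.natDegree_C_mul_le _ _).trans ?_
  rw [Polynomial.natDegree_pow, Polynomial.natDegree_X_sub_C]
  omega

/-- The coefficient of y^i in B_j (y - f^m)^(t+j) is a constant times B_j f^(m(t+j-i)); the power of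
f restores exactly the multiple of G by which B_j falls short. -/
theorem coeff_shiftedPoly_mem {m t N : ℕ} {A G : Divisor K F} {f : F} (hf : f ∈ L G)
    {B : Fin N → F} (hB : ∀ j : Fin N, B j ∈ L (A - (m * (t + j)) • G)) (i : ℕ) :
    (shiftedPoly (f ^ m) t B).coeff i ∈ L (A - (m * i) • G) := by
  rw [shiftedPoly, Polynomial.finsetSum_coeff]
  refine Submodule.sum_mem _ fun j _ => ?_
  rw [Polynomial.coeff_C_mul, sub_eq_add_neg Polynomial.X, ← Polynomial.C_neg,
    Polynomial.coeff_X_add_C_pow]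
  rcases le_or_gt i (t + j) with h | h
  · have h1 := mul_mem_L (hB j) (pow_mem_L hf (m * (t + j - i)))
    have h2 : A - (m * (t + j)) • G + (m * (t + j - i)) • G = A - (m * i) • G := by
      have : m * (t + (j : ℕ)) = m * i + m * (t + j - i) := by
        rw [← mul_add]; congr 1; omega
      rw [this, add_nsmul]
      abel
    rw [h2] at h1
    have h3 : B j * ((-f ^ m) ^ (t + (j : ℕ) - i) * ((t + (j : ℕ)).choose i : F)) =
        ((-1 : K) ^ (t + (j : ℕ) - i) * ((t + (j : ℕ)).choose i : K)) •
          (B j * f ^ (m * (t + j - i))) := by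
      rw [Algebra.smul_def, neg_pow, ← pow_mul]
      simp
      ring
    rw [h3]
    exact Submodule.smul_mem _ _ h1
  · rw [Nat.choose_eq_zero_of_lt h]
    simp

theorem coeff_taylor_shiftedPoly_mem_ring {m t N : ℕ} {A G : Divisor K F} {P : Place K F}
    (hG : G P = 0) (hA : A P = 0) {f : F} (hf : f ∈ L G) {B : Fin N → F}
    (hB : ∀ j : Fin N, B j ∈ L (A - (m * (t + j)) • G)) {x : F} (hx : x ∈ P.ring) (b : ℕ) :
    (Polynomial.taylor x (shiftedPoly (f ^ m) t B)).coeff b ∈ P.ring := by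
  rw [← Place.val_le_one_iff]
  have h := Place.val_coeff_taylor_le (P := P) (m := 0) (s := 0)
    (S := shiftedPoly (f ^ m) t B) (δ := x)
    (fun k => by
      have := mem_ring_of_mem_L (by simp [hA, hG]) (coeff_shiftedPoly_mem hf hB k) (P := P)
      simpa [Place.val_le_one_iff] using this)
    (by simpa [Place.val_le_one_iff] using hx) b
  simpa using h

theorem exists_shiftedPoly_val_le [IsAlgFunctionField K F] {m t k s n : ℕ}
    {P : Fin n → Place K F} (hPrat : ∀ i, (P i).IsRational)
    {G A : Divisor K F} (hG : ∀ i, G (P i) = 0) (hA : ∀ i, A (P i) = 0) {f : F} (hf : f ∈ L G)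
    {ρ : Fin n → F} (hρ : ∀ i, ρ i ∈ (P i).ring) (N : Fin n → ℕ → ℕ)
    (hN : ((∑ i, ∑ b ∈ Finset.range s, N i b : ℕ) : ℤ) <
      ∑ j : Fin (k + 1), (degree A - (m * (t + j) : ℕ) * degree G + 1 - genus K F)) :
    ∃ B : Fin (k + 1) → F, (∀ j : Fin (k + 1), B j ∈ L (A - (m * (t + j)) • G)) ∧ B ≠ 0 ∧
      ∀ i, ∀ b < s, (P i).val ((Polynomial.taylor (ρ i) (shiftedPoly (f ^ m) t B)).coeff b) ≤
        WithZero.exp (-(N i b : ℤ)) := by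
  let g : Fin n × Fin s → (∀ j : Fin (k + 1), L (A - (m * (t + j)) • G)) →ₗ[K] F := fun ib =>
    { toFun := fun B =>
        (Polynomial.taylor (ρ ib.1) (shiftedPoly (f ^ m) t fun j => (B j : F))).coeff ib.2
      map_add' := fun B B' => by
        have := shiftedPoly_add (f ^ m) t (fun j => (B j : F)) (fun j => (B' j : F))
        rw [← Polynomial.coeff_add, ← map_add, ← this]
        rfl
      map_smul' := fun c B => by
        have := shiftedPoly_smul (f ^ m) t c (fun j => (B j : F))
        rw [RingHom.id_apply, Algebra.smul_def, ← smul_eq_mul, ← Polynomial.coeff_smul,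
          ← map_smul, ← this]
        rfl }
  have hdim : ∑ ib : Fin n × Fin s, N ib.1 ib.2 <
      finrank K (∀ j : Fin (k + 1), L (A - (m * (t + j)) • G)) := by
    have h1 : finrank K (∀ j : Fin (k + 1), L (A - (m * (t + j)) • G)) =
        ∑ j : Fin (k + 1), finrank K (L (A - (m * (t + j)) • G)) := Module.finrank_pi_fintype K
    rw [h1, Fintype.sum_prod_type]
    have h2 : ∀ i, ∑ b : Fin s, N i b = ∑ b ∈ Finset.range s, N i b := fun i =>
      Fin.sum_univ_eq_sum_range (N i) s
    rw [Finset.sum_congr rfl fun i _ => h2 i, ← Nat.cast_lt (α := ℤ)]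
    refine lt_of_lt_of_le hN ?_
    rw [Nat.cast_sum]
    refine Finset.sum_le_sum fun j _ => ?_
    have := degree_add_one_sub_genus_le (A - (m * (t + j)) • G)
    rwa [degree_sub, degree_nsmul] at this
  obtain ⟨B, hB0, hB⟩ := Place.exists_ne_zero_of_sum_lt (fun ib : Fin n × Fin s => P ib.1)
    (fun ib => hPrat ib.1) g (fun ib B => coeff_taylor_shiftedPoly_mem_ring (hG ib.1) (hA ib.1) hf
      (fun j => (B j).2) (hρ ib.1) ib.2) (fun ib => N ib.1 ib.2) hdim
  refine ⟨fun j => B j, fun j => (B j).2, fun h => hB0 ?_, fun i b hb => hB (i, ⟨b, hb⟩)⟩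
  exact funext fun j => Subtype.ext (congrFun h j)

/-- A position in E pays for every b < t + u, and any other position only for b ≥ t. -/
theorem sum_ite_mem_eq (m t u : ℕ) {n : ℕ} (E : Finset (Fin n)) :
    ((∑ i, ∑ b ∈ Finset.range (t + u),
      (if i ∉ E ∧ b < t then 0 else m * (t + u - b)) : ℕ) : ℤ) =
      E.card * (m * (t + u + 1).choose 2 : ℕ) +
        ((n : ℤ) - E.card) * (m * (u + 1).choose 2 : ℕ) := by
  have h3 : (Eᶜ.card : ℤ) = (n : ℤ) - E.card := by
    rw [Finset.card_compl, Fintype.card_fin, Nat.cast_sub]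
    simpa using E.card_le_univ
  rw [← h3, ← Nat.cast_mul, ← Nat.cast_mul, ← Nat.cast_add, Nat.cast_inj,
    ← Finset.sum_add_sum_compl E]
  congr 1
  · rw [← smul_eq_mul, ← Finset.sum_const]
    refine Finset.sum_congr rfl fun i hi => ?_
    rw [← sum_range_sub, Finset.mul_sum]
    exact Finset.sum_congr rfl fun b _ => if_neg fun h => h.1 hi
  · rw [← smul_eq_mul, ← Finset.sum_const]
    refine Finset.sum_congr rfl fun i hi => ?_
    rw [← sum_range_ite_sub t u, Finset.mul_sum]
    refine Finset.sum_congr rfl fun b _ => ?_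
    simp [Finset.mem_compl.1 hi]

theorem expand_shiftedPoly_isInterpolationPolynomial {p e t k s n : ℕ} (hp : 0 < p)
    [ExpChar F p] {P : Fin n → Place K F} (hPrat : ∀ i, (P i).IsRational)
    {G A : Divisor K F} {f : F} (hf : f ∈ L G) {r : Fin n → K} {B : Fin (k + 1) → F}
    (hB : ∀ j : Fin (k + 1), B j ∈ L (A - (p ^ e * (t + j)) • G)) (hB0 : B ≠ 0)
    (hval : ∀ i b, (P i).val ((Polynomial.taylor (algebraMap K F (r i) ^ p ^ e)
      (shiftedPoly (f ^ p ^ e) t B)).coeff b) ≤ WithZero.exp (-((p ^ e * (s - b) : ℕ) : ℤ))) :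
    IsInterpolationPolynomial p e s (t + k) P r G A
      (Polynomial.expand F (p ^ e) (shiftedPoly (f ^ p ^ e) t B)) := by
  have hm0 : 0 < p ^ e := pow_pos hp e
  have hR0 : shiftedPoly (f ^ p ^ e) t B ≠ 0 := by
    intro h
    refine hB0 (funext fun j => ?_)
    rw [← coeff_taylor_shiftedPoly_add (f ^ p ^ e) t B j, h]
    simp
  have hQ0 : Polynomial.expand F (p ^ e) (shiftedPoly (f ^ p ^ e) t B) ≠ 0 := by
    rwa [Ne, Polynomial.expand_eq_zero hm0]
  refine ⟨hQ0, ⟨(shiftedPoly (f ^ p ^ e) t B).coeff, ?_,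
    fun j _ => coeff_shiftedPoly_mem hf hB j⟩, fun i => ?_⟩
  · rw [sum_C_mul_X_pow_eq_expand, ← Polynomial.as_sum_range_C_mul_X_pow']
    exact Nat.lt_succ_of_le (natDegree_shiftedPoly_le _ _ _ _)
  · refine (hPrat i).hasZeroOfMultiplicityAtLeast hQ0 fun b => ?_
    -- The Taylor expansion of R(z^m) at r is that of R at r^m with X^m substituted. So only indices
    -- b = mc occur, where ms - mc = m(s - c).
    rw [taylor_expand_pow_char, Polynomial.coeff_expand hm0]
    split_ifs with hdvd
    · obtain ⟨c, rfl⟩ := hdvd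
      rw [Nat.mul_div_cancel_left c hm0, ← Nat.mul_sub]
      exact hval i c
    · rw [map_zero]
      exact zero_le

/-- Existence of interpolation polynomials. -/
theorem exists_isInterpolationPolynomial [IsAlgFunctionField K F] {p e t u k n : ℕ} (hp : 0 < p)
    [ExpChar F p] {P : Fin n → Place K F} (hPrat : ∀ i, (P i).IsRational)
    {G A : Divisor K F} (hG : ∀ i, G (P i) = 0) (hA : ∀ i, A (P i) = 0) {f : F} (hf : f ∈ L G)
    {r : Fin n → K} {E : Finset (Fin n)} (hE : ∀ i ∉ E, r i = (P i).eval f)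
    (hcount : (E.card * (p ^ e * (t + u + 1).choose 2 : ℕ) +
      ((n : ℤ) - E.card) * (p ^ e * (u + 1).choose 2 : ℕ))
      < ∑ j : Fin (k + 1), (degree A - (p ^ e * (t + j) : ℕ) * degree G + 1 - genus K F)) :
    ∃ Q : F[X], IsInterpolationPolynomial p e (t + u) (t + k) P r G A Q := by
  have hfP : ∀ i, f ∈ (P i).ring := fun i => mem_ring_of_mem_L (hG i) hf
  -- The centre is r_i^m at error positions, but f^m at correct ones, where it makes the
  -- coefficients with b < t vanish for free.
  let ρ : Fin n → F := fun i => if i ∈ E then algebraMap K F (r i) ^ p ^ e else f ^ p ^ e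
  have hρ : ∀ i, ρ i ∈ (P i).ring := fun i => by
    by_cases hi : i ∈ E
    · simpa [ρ, hi] using pow_mem ((P i).algebraMap_mem (r i)) (p ^ e)
    · simpa [ρ, hi] using pow_mem (hfP i) (p ^ e)
  rw [← sum_ite_mem_eq] at hcount
  obtain ⟨B, hB, hB0, hBval⟩ := exists_shiftedPoly_val_le hPrat hG hA hf hρ _ hcount
  refine ⟨_, expand_shiftedPoly_isInterpolationPolynomial hp hPrat hf hB hB0 fun i b => ?_⟩
  have hlow : ∀ b, (P i).val ((Polynomial.taylor (ρ i) (shiftedPoly (f ^ p ^ e) t B)).coeff b) ≤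
      WithZero.exp (-((p ^ e * (t + u - b) : ℕ) : ℤ)) := by
    intro b
    rcases lt_or_ge b (t + u) with hb | hb
    · have h := hBval i b hb
      split_ifs at h with hib
      · have : ρ i = f ^ p ^ e := if_neg hib.1
        rw [this, coeff_taylor_shiftedPoly_of_lt _ _ hib.2, map_zero]
        exact zero_le
      · exact h
    · rw [Nat.sub_eq_zero_of_le hb]
      simpa [Place.val_le_one_iff] using
        coeff_taylor_shiftedPoly_mem_ring (hG i) (hA i) hf hB (hρ i) b
  -- At a correct position r_i^m - f^m = (r_i - f)^m has order at least m, just enough to move the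
  -- centre back to r_i^m without loss.
  have hδ : (P i).val (algebraMap K F (r i) ^ p ^ e - ρ i) ≤
      WithZero.exp (-((p ^ e : ℕ) : ℤ)) := by
    by_cases hi : i ∈ E
    · simp [ρ, hi]
    · simp only [ρ, if_neg hi]
      rw [← sub_pow_expChar_pow, map_pow, Valuation.map_sub_swap, hE i hi]
      refine (pow_le_pow_left' ((hPrat i).val_sub_eval_le (hfP i)) (p ^ e)).trans_eq ?_
      rw [← WithZero.exp_nsmul]
      simp
  have h := Place.val_coeff_taylor_le hlow hδ b
  rwa [Polynomial.taylor_taylor, sub_add_cancel] at h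

end Existence

end AGCode

end

theorem theorem3p1
    {Fq F : Type*} [Field Fq] [Finite Fq] [DecidableEq Fq] [Field F] [Algebra Fq F]
    [Algebra (RatFunc Fq) F] [IsScalarTower Fq (RatFunc Fq) F] [FunctionField Fq F]
    -- `Fq` is the full constant field of `F`
    (hconst : ∀ x : F, IsAlgebraic Fq x → x ∈ Set.range (algebraMap Fq F))
    (p : ℕ) [CharP Fq p]
    (n : ℕ) (P : Fin n → AGCode.Place Fq F) (hPinj : Function.Injective P)
    (hPrat : ∀ i, (P i).IsRational)
    (G : AGCode.Divisor Fq F) (hG : Disjoint G.support (AGCode.Divisor.ofPoints P).support)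
    (f : F) (hf : f ∈ AGCode.Divisor.L G)
    (r : Fin n → Fq) (τ : ℕ) (hτ : τ = hammingNorm (r - AGCode.evD P f))
    (t s ℓ e : ℕ) (hts : t ≤ s) (hsℓ : s ≤ ℓ) (hs : 1 ≤ s)
    (hτt : (τ : ℚ) ≤ AGCode.radius p e n s ℓ t (AGCode.Divisor.degree G) (AGCode.genus Fq F))
    (A : AGCode.Divisor Fq F) (hA : Disjoint A.support (AGCode.Divisor.ofPoints P).support)
    (hAdeg : AGCode.Divisor.degree A < (p : ℤ) ^ e * s * ((n : ℤ) - τ)) :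
    -- existence, for `deg A` not too small; in particular for `deg A = p ^ e * s * (n - τ) - 1`
    ((p : ℚ) ^ e * s * ((n : ℚ) - AGCode.radius p e n s ℓ t (AGCode.Divisor.degree G) (AGCode.genus Fq F)) - 1
        ≤ (AGCode.Divisor.degree A : ℚ) →
      ∃ Q : Polynomial F, AGCode.IsInterpolationPolynomial p e s ℓ P r G A Q) ∧
    ∀ Q : Polynomial F, AGCode.IsInterpolationPolynomial p e s ℓ P r G A Q →
      {x : F | Q.IsRoot x}.encard ≤ ℓ ∧ Q.IsRoot f := by
  have hF : AGCode.IsAlgFunctionField Fq F := AGCode.isAlgFunctionField_of_functionField hconst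
  have hp : p.Prime := CharP.char_is_prime Fq p
  have hchar : CharP F p := charP_of_injective_algebraMap (algebraMap Fq F).injective p
  have hexp : ExpChar F p := ExpChar.prime hp
  have hG0 := AGCode.Divisor.apply_eq_zero_of_disjoint hG
  have hA0 := AGCode.Divisor.apply_eq_zero_of_disjoint hA
  let E : Finset (Fin n) := Finset.univ.filter fun i => (r - AGCode.evD P f) i ≠ 0
  have hE : ∀ i ∉ E, r i = (P i).eval f := fun i hi => by
    simpa [E, AGCode.evD, sub_eq_zero] using hi
  have hEτ : E.card = τ := by rw [hτ, hammingNorm]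
  have hEc : ((Eᶜ.card : ℕ) : ℤ) = (n : ℤ) - τ := by
    rw [Finset.card_compl, Fintype.card_fin, hEτ, Nat.cast_sub]
    rw [← hEτ]
    simpa using E.card_le_univ
  refine ⟨fun hdeg => ?_, fun Q hQ => ⟨?_, ?_⟩⟩
  · obtain ⟨u, rfl⟩ := Nat.exists_eq_add_of_le hts
    obtain ⟨k, rfl⟩ := Nat.exists_eq_add_of_le (hts.trans hsℓ)
    have hcount := AGCode.count_lt p e n t u k τ hp.pos hs _ _ _ hAdeg hdeg
    rw [← hEτ] at hcount
    exact AGCode.exists_isInterpolationPolynomial hp.pos hPrat hG0 hA0 hf hE hcount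
  · obtain ⟨hQ0, ⟨q, hq, -⟩, -⟩ := hQ
    exact AGCode.encard_setOf_isRoot_le p e ℓ q hQ0 hq
  · refine AGCode.isRoot_of_isInterpolationPolynomial hPinj hPrat hG0 hA0 hf (I := Eᶜ)
      (fun i hi => hE i (Finset.mem_compl.1 hi)) ?_ hQ
    rwa [hEc]
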